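/- Let $k>0$ and $r\ge 0$ be integers, let $\alpha=(\alpha_1,\dots,\alpha_r)$ be integers with $1\le\alpha_i\le k$, and put $n=\alpha_1+\cdots+\alpha_r$. For $1\le i\le r$, the $i$-th batch of positions consists of $\alpha_1+\cdots+\alpha_{i-1}+j$ for $1\le j\le\alpha_i$; write $\mathbf x_n=(x_1,\dots,x_n)$ and let $\mathbf x_n^{(i)}$ be the variables $x_p$ with $p$ in the $i$-th batch. Let $\mathfrak S_\alpha=\mathfrak S_{\alpha_1}\times\cdots\times\mathfrak S_{\alpha_r}\subseteq\mathfrak S_n$ be the group of permutations mapping each batch to itself. Let $I_{\alpha,k}\subseteq\mathbb Z[\mathbf x_n]$ be the ideal generated by the elementary symmetric polynomials $e_d(\mathbf x_n)$ for $n-k+1\le d\le n$ (with $e_0=1$ and $e_d=0$ for $d<0$) together with the complete homogeneous symmetric polynomials $h_d(\mathbf x_n^{(i)})$ for $1\le i\le r$ and $k-\alpha_i+1\le d\le k$. Let $R_{\alpha,k}=\mathbb Z[\mathbf x_n]/I_{\alpha,k}$, on which $\mathfrak S_\alpha$ acts by permuting variables. Let $\mathcal{OP}_{\alpha,k}$ be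 the set of sequences $(B_1\mid\cdots\mid B_k)$ of nonempty, pairwise disjoint subsets of $\{1,\dots,n\}$ with union $\{1,\dots,n\}$ such that, for each $i$, the elements of the $i$-th batch lie in distinct blocks. For $S=\{s_1<\cdots<s_t\}\subseteq\{1,\dots,n\}$ let $\gamma(S)=(\gamma_1,\dots,\gamma_n)$, where $\gamma_{s_j}=s_j-j+1$ and $\gamma_p=0$ for $p\notin S$, and let $\mathbf x(S)^*=x_1^{\gamma_n}x_2^{\gamma_{n-1}}\cdots x_n^{\gamma_1}$. A monomial $m$ in $x_1,\dots,x_n$ is $\alpha$-nonskip if $\mathbf x(S)^*\nmid m$ for every $S\subseteq\{1,\dots,n\}$ with $|S|=\max(n-k+1,0)$, and $x_{\alpha_1+\cdots+\alpha_{i-1}+j}^{\,k-j+1}\nmid m$ for all $1\le i\le r$ and $1\le j\le\alpha_i$. Then: 1. $R_{\alpha,k}$ is a free $\mathbb Z$-module of finite rank $|\mathcal{OP}_{\alpha,k}|$, and the classes of the distinct $\alpha$-nonskip monomials form a $\mathbb Z$-basis of it. 2. The invariant subring $(R_{\alpha,k})^{\mathfrak S_\alpha}$ is a free $\mathbb Z$-module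 of finite rank $|\mathcal{OP}_{\alpha,k}|/(\alpha_1!\cdots\alpha_r!)$. -/

import Mathlib

open MvPolynomial

/-- The size `|α| = α₁ + ⋯ + αᵣ` of the sequence `α`. -/
abbrev compSize {r : ℕ} (α : Fin r → ℕ) : ℕ := ∑ i, α i

/-- The position `α₁ + ⋯ + αᵢ₋₁ + j` of the `j`-th member of the `i`-th batch. All indices are
counted from zero here: `i : Fin r` and `j : Fin (α i)`. -/
def batchIndex {r : ℕ} (α : Fin r → ℕ) (i : Fin r) (j : Fin (α i)) : Fin (compSize α) :=
  finSigmaFinEquiv ⟨i, j⟩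

/-- The batch to which a position belongs. -/
def batchOf {r : ℕ} (α : Fin r → ℕ) (p : Fin (compSize α)) : Fin r :=
  (finSigmaFinEquiv.symm p).1

theorem batchIndex_val {r : ℕ} (α : Fin r → ℕ) (i : Fin r) (j : Fin (α i)) :
    (batchIndex α i j : ℕ) = ∑ l : Fin i, α (Fin.castLE i.2.le l) + j := by
  simp [batchIndex]

theorem batchOf_batchIndex {r : ℕ} (α : Fin r → ℕ) (i : Fin r) (j : Fin (α i)) :
    batchOf α (batchIndex α i j) = i := by
  simp [batchOf, batchIndex]

theorem batchIndex_injective {r : ℕ} (α : Fin r → ℕ) (i : Fin r) :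
    Function.Injective (batchIndex α i) := by
  intro a b h
  simpa [batchIndex] using h

theorem exists_batchIndex {r : ℕ} (α : Fin r → ℕ) (i : Fin r) (p : Fin (compSize α))
    (h : batchOf α p = i) : ∃ j : Fin (α i), batchIndex α i j = p := by
  subst h
  exact ⟨(finSigmaFinEquiv.symm p).2, by simp [batchIndex, batchOf]⟩

/-- The parabolic subgroup `𝔖_α ⊆ 𝔖_n` of permutations that map every batch to itself. -/
def parabolic {r : ℕ} (α : Fin r → ℕ) : Subgroup (Equiv.Perm (Fin (compSize α))) where
  carrier := {w | ∀ p, batchOf α (w p) = batchOf α p}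
  one_mem' := fun _ => rfl
  mul_mem' := by
    intro a b ha hb p
    rw [Equiv.Perm.mul_apply, ha, hb]
  inv_mem' := by
    intro a ha p
    have h := ha (a⁻¹ p)
    have h2 : a (a⁻¹ p) = p := a.apply_symm_apply p
    rw [h2] at h
    exact h.symm

/-- `σ = (σ 0 ∣ ⋯ ∣ σ (k-1))` is an ordered set partition of an `n`-element set of letters into
`k` (nonempty) blocks. -/
structure IsOrderedSetPartition {n k : ℕ} (σ : Fin k → Finset (Fin n)) : Prop where
  nonempty : ∀ b, (σ b).Nonempty
  disjoint : ∀ b c, b ≠ c → Disjoint (σ b) (σ c)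
  cover : ∀ p, ∃ b, p ∈ σ b

/-- The set `OP_{α,k}`: ordered set partitions with `k` blocks in which the letters of each batch
lie in distinct blocks. -/
def orderedPartitions {r : ℕ} (α : Fin r → ℕ) (k : ℕ) :
    Set (Fin k → Finset (Fin (compSize α))) :=
  {σ | IsOrderedSetPartition σ ∧
    ∀ (i : Fin r) (j j' : Fin (α i)), j ≠ j' →
      ∀ b, ¬ (batchIndex α i j ∈ σ b ∧ batchIndex α i j' ∈ σ b)}

/-- The complete homogeneous symmetric polynomial `h_d` in the `i`-th batch of variables. -/
noncomputable def batchHsymm {r : ℕ} (α : Fin r → ℕ) (i : Fin r) (d : ℕ) :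
    MvPolynomial (Fin (compSize α)) ℤ :=
  rename (batchIndex α i) (hsymm (Fin (α i)) ℤ d)

/-- The ideal `I_{α,k}`, generated by `e_d(x₁, …, x_n)` for `n - k + 1 ≤ d ≤ n` and by
`h_d` of the `i`-th batch of variables for `k - αᵢ + 1 ≤ d ≤ k`. (When `k > n` the elementary
generators include `e_0 = 1`; those of negative degree are zero.) -/
noncomputable def idealI {r : ℕ} (α : Fin r → ℕ) (k : ℕ) :
    Ideal (MvPolynomial (Fin (compSize α)) ℤ) :=
  Ideal.span
    ({f | ∃ d : ℕ, compSize α + 1 ≤ d + k ∧ d ≤ compSize α ∧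
        f = esymm (Fin (compSize α)) ℤ d} ∪
     {f | ∃ (i : Fin r) (d : ℕ), k + 1 ≤ d + α i ∧ d ≤ k ∧ f = batchHsymm α i d})

/-- The ring `R_{α,k} = ℤ[x₁, …, x_n] / I_{α,k}`. -/
abbrev ringR {r : ℕ} (α : Fin r → ℕ) (k : ℕ) : Type :=
  MvPolynomial (Fin (compSize α)) ℤ ⧸ idealI α k

theorem rename_batchHsymm {r : ℕ} (α : Fin r → ℕ) (w : parabolic α) (i : Fin r) (d : ℕ) :
    rename (w : Equiv.Perm (Fin (compSize α))) (batchHsymm α i d) = batchHsymm α i d := by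
  have h : ∀ j : Fin (α i), ∃ j' : Fin (α i), batchIndex α i j' = w.1 (batchIndex α i j) := by
    intro j
    have hb : batchOf α (w.1 (batchIndex α i j)) = i := by
      rw [w.2 _, batchOf_batchIndex]
    exact exists_batchIndex α i _ hb
  choose g hg using h
  have hinj : Function.Injective g := by
    intro a b hab
    apply batchIndex_injective α i
    apply w.1.injective
    rw [← hg, ← hg, hab]
  let e : Fin (α i) ≃ Fin (α i) :=
    Equiv.ofBijective g (Finite.injective_iff_bijective.mp hinj)
  have hcomp : (w.1 : Fin (compSize α) → Fin (compSize α)) ∘ batchIndex α i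
      = batchIndex α i ∘ e := by
    funext j
    exact (hg j).symm
  rw [batchHsymm, rename_rename, hcomp, ← rename_rename, rename_hsymm]

theorem idealI_le_comap {r : ℕ} (α : Fin r → ℕ) (k : ℕ) (w : parabolic α) :
    idealI α k ≤
      (idealI α k).comap (rename (R := ℤ) (w : Equiv.Perm (Fin (compSize α)))) := by
  rw [idealI, Ideal.span_le]
  rintro f (⟨d, h1, h2, rfl⟩ | ⟨i, d, h1, h2, rfl⟩)
  · rw [SetLike.mem_coe, Ideal.mem_comap, rename_esymm]
    exact Ideal.subset_span (Or.inl ⟨d, h1, h2, rfl⟩)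
  · rw [SetLike.mem_coe, Ideal.mem_comap, rename_batchHsymm]
    exact Ideal.subset_span (Or.inr ⟨i, d, h1, h2, rfl⟩)

/-- The action of `w ∈ 𝔖_α` on `R_{α,k}` induced by the permutation `x_p ↦ x_{w(p)}` of the
variables. -/
noncomputable def permAct {r : ℕ} (α : Fin r → ℕ) (k : ℕ) (w : parabolic α) :
    ringR α k →ₐ[ℤ] ringR α k :=
  Ideal.quotientMapₐ (idealI α k) (rename (w : Equiv.Perm (Fin (compSize α))))
    (idealI_le_comap α k w)

/-- The invariant subring `(R_{α,k})^{𝔖_α}`. -/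
noncomputable def invariantSubring {r : ℕ} (α : Fin r → ℕ) (k : ℕ) :
    Subalgebra ℤ (ringR α k) :=
  ⨅ w : parabolic α, AlgHom.equalizer (permAct α k w) (AlgHom.id ℤ (ringR α k))

theorem mem_invariantSubring {r : ℕ} (α : Fin r → ℕ) (k : ℕ) (x : ringR α k) :
    x ∈ invariantSubring α k ↔ ∀ w : parabolic α, permAct α k w x = x := by
  simp [invariantSubring, Algebra.mem_iInf, AlgHom.mem_equalizer]

/-- The skip sequence `γ(S)`: if the (one-based) position of `i` is the `j`-th smallest element of
`S`, the entry is `position - j + 1`; it is zero outside `S`. -/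
def skipSeq {n : ℕ} (S : Finset (Fin n)) (i : Fin n) : ℕ :=
  if i ∈ S then ((i : ℕ) + 1) - (S.filter (· ≤ i)).card + 1 else 0

/-- The reverse skip sequence `γ(S)^*`, the exponent vector of the reverse skip monomial. -/
def revSkipSeq {n : ℕ} (S : Finset (Fin n)) (i : Fin n) : ℕ := skipSeq S i.rev

/-- The set of exponent vectors of the `α`-nonskip monomials: no reverse skip monomial of a set
`S` with `|S| = n - k + 1` divides the monomial, and neither does the `(k - j + 1)`-st power of the
`j`-th variable of a batch. Divisibility of monomials is
expressed as the componentwise order of exponent vectors. The size `n + 1 - k` is truncated at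
zero, so that there is no such monomial when `k > n`. The index `j` is counted from zero
below, which turns `k - j + 1` into `k - j`. -/
def nonskip {r : ℕ} (α : Fin r → ℕ) (k : ℕ) : Set (Fin (compSize α) →₀ ℕ) :=
  {m | (∀ S : Finset (Fin (compSize α)), S.card = compSize α + 1 - k →
          ¬ ∀ p, revSkipSeq S p ≤ m p) ∧
       ∀ (i : Fin r) (j : Fin (α i)), ¬ k - (j : ℕ) ≤ m (batchIndex α i j)}

/-! The ideal is deformed so that its quotient becomes functions on a finite set of points. For
parameters z_1, …, z_k, `deformedIdeal` is generated by the coefficients of ∏(T - x_p) modulo ∏(T -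
z_b) and by the coefficients of ∏(1 - z_b u) / ∏(1 - x_p u), p in the i-th batch, in degrees k - α_i
+ 1 to k. At z = 0 this is I_{α,k}. It vanishes at every point (z_{φ(p)}) with φ surjective and
injective on batches, and such φ correspond to the elements of OP_{α,k}.

Upper bound, for every z: the ideal contains polynomials with leading coefficient one whose leading
exponents rule out everything but `standardExps` (`exists_leads_mem_deformedIdeal`), so the standard
monomials span the quotient. The batch generators yield pure powers; the remainder generators yield
the skip monomials through minors of a matrix of remainders. `nonskip_eq_standardExps` identifies
standard with nonskip.

Lower bound: there are as many standard monomials as points (`card_standardExps_eq_card_blockMap`;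
both counts equal the same alternating sum). For distinct z_b in a field, polynomials realize all
functions on the points, so the spanning standard monomials give a basis of these functions. Taking
z_b = b t over ℤ[t] gives independence modulo the deformed ideal, and the spanning statement over
ℤ[t] carries it to t = 0 (`eq_zero_of_sum_mem_idealI`).

Invariants: a nontrivial element of 𝔖_α fixes none of the points, so its trace is zero over ℤ[t] and
hence on R_{α,k} (`trace_permAct_eq_zero`). Comparing traces for the sum over the group then gives
|𝔖_α| · rank of the invariants = rank of R_{α,k} (`card_mul_finrank_invariantSubring`). -/

/-- Reads an exponent vector from its last entry to its first one, starting in the state `c`; the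
state increases by one at every entry that does not exceed it. -/
def skipCount : (N : ℕ) → (Fin N → ℕ) → ℕ → ℕ
  | 0, _, c => c
  | N + 1, e, c =>
    if e (Fin.last N) ≤ c then skipCount N (fun i => e i.castSucc) (c + 1)
    else skipCount N (fun i => e i.castSucc) c

/-! ### Leading exponents, with the last variable most significant -/

/-- The lexicographic order of exponent vectors in which the last entry is the most significant. -/
def RevLexLT {N : ℕ} (a b : Fin N →₀ ℕ) : Prop :=
  ∃ p, a p < b p ∧ ∀ q, p < q → a q = b q

theorem wellFounded_revLexLT (N : ℕ) : WellFounded (RevLexLT (N := N)) := by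
  have h := Pi.Lex.wellFounded (ι := Fin N) (α := fun _ => ℕ) (r := (· > ·))
    (s := fun _ => (· < ·)) (fun _ => wellFounded_lt)
  refine Subrelation.wf ?_ (InvImage.wf (fun a : Fin N →₀ ℕ => (a : Fin N → ℕ)) h)
  rintro a b ⟨p, h1, h2⟩
  exact ⟨p, fun q hq => h2 q hq, h1⟩

theorem RevLexLT.add_left {N : ℕ} {a b : Fin N →₀ ℕ} (h : RevLexLT a b) (c : Fin N →₀ ℕ) :
    RevLexLT (c + a) (c + b) := by
  obtain ⟨p, h1, h2⟩ := h
  exact ⟨p, by simpa using h1, fun q hq => by simp [h2 q hq]⟩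

/-- `d` is the leading exponent of `f` for `RevLexLT`, and its coefficient is one. -/
def Leads {N : ℕ} {S : Type*} [CommRing S] (f : MvPolynomial (Fin N) S) (d : Fin N →₀ ℕ) : Prop :=
  coeff d f = 1 ∧ ∀ m, coeff m f ≠ 0 → m = d ∨ RevLexLT m d

/-- The restriction of an exponent vector to all variables but the last one. -/
noncomputable def initExp {N : ℕ} (m : Fin (N + 1) →₀ ℕ) : Fin N →₀ ℕ :=
  Finsupp.equivFunOnFinite.symm fun i => m i.castSucc

@[simp] theorem initExp_apply {N : ℕ} (m : Fin (N + 1) →₀ ℕ) (i : Fin N) :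
    initExp m i = m i.castSucc := rfl

/-- An exponent vector extended by a last entry. -/
noncomputable def snocExp {N : ℕ} (m : Fin N →₀ ℕ) (a : ℕ) : Fin (N + 1) →₀ ℕ :=
  Finsupp.equivFunOnFinite.symm (Fin.snoc (α := fun _ => ℕ) m a)

@[simp] theorem snocExp_last {N : ℕ} (m : Fin N →₀ ℕ) (a : ℕ) :
    snocExp m a (Fin.last N) = a := by simp [snocExp]

@[simp] theorem snocExp_castSucc {N : ℕ} (m : Fin N →₀ ℕ) (a : ℕ) (i : Fin N) :
    snocExp m a i.castSucc = m i := by simp [snocExp]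

@[simp] theorem initExp_snocExp {N : ℕ} (m : Fin N →₀ ℕ) (a : ℕ) :
    initExp (snocExp m a) = m := by ext; simp

theorem eq_snocExp_iff {N : ℕ} (m : Fin (N + 1) →₀ ℕ) (s : Fin N →₀ ℕ) (a : ℕ) :
    m = snocExp s a ↔ initExp m = s ∧ m (Fin.last N) = a := by
  constructor
  · rintro rfl; simp
  · rintro ⟨rfl, rfl⟩
    ext i
    refine Fin.lastCases ?_ (fun i => ?_) i <;> simp

theorem mapDomain_add_single_last {N : ℕ} (s : Fin N →₀ ℕ) (a : ℕ) :
    s.mapDomain Fin.castSucc + Finsupp.single (Fin.last N) a = snocExp s a := by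
  rw [eq_snocExp_iff]
  have h : ∀ i : Fin N, s.mapDomain Fin.castSucc i.castSucc = s i := fun i =>
    Finsupp.mapDomain_apply (Fin.castSucc_injective N) s i
  constructor
  · ext i
    simp [h, Fin.castSucc_ne_last]
  · rw [Finsupp.add_apply, Finsupp.mapDomain_of_notMem_range]
    · simp
    · rintro ⟨i, hi⟩
      exact Fin.castSucc_ne_last i hi

theorem coeff_eval₂_last {N : ℕ} {S : Type*} [CommRing S]
    (D : Polynomial (MvPolynomial (Fin N) S)) (m : Fin (N + 1) →₀ ℕ) :
    coeff m (D.eval₂ (rename Fin.castSucc : MvPolynomial (Fin N) S →ₐ[S] _).toRingHom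
      (X (Fin.last N))) = coeff (initExp m) (D.coeff (m (Fin.last N))) := by
  induction D using Polynomial.induction_on' with
  | add p q hp hq => rw [Polynomial.eval₂_add, coeff_add, hp, hq, Polynomial.coeff_add, coeff_add]
  | monomial a g =>
    rw [Polynomial.eval₂_monomial, Polynomial.coeff_monomial]
    induction g using MvPolynomial.induction_on' with
    | add p q hp hq =>
      rw [map_add, add_mul, coeff_add, hp, hq]
      split_ifs <;> simp
    | monomial s c =>
      have h : (rename Fin.castSucc : MvPolynomial (Fin N) S →ₐ[S] _).toRingHom (monomial s c)
          = monomial (s.mapDomain Fin.castSucc) c := by simp [rename_monomial]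
      rw [h, X_pow_eq_monomial, monomial_mul, mul_one, mapDomain_add_single_last, coeff_monomial]
      by_cases h1 : a = m (Fin.last N) <;> by_cases h2 : s = initExp m
      · rw [if_pos ((eq_snocExp_iff m s a).2 ⟨h2.symm, h1.symm⟩).symm, if_pos h1, coeff_monomial,
          if_pos h2]
      all_goals
        rw [if_neg fun h => by
          obtain ⟨h3, h4⟩ := (eq_snocExp_iff m s a).1 h.symm
          first
          | exact h1 h4.symm
          | exact h2 h3.symm]
        simp [h1, h2]

theorem RevLexLT.of_last {N : ℕ} {m d : Fin (N + 1) →₀ ℕ}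
    (h : m (Fin.last N) < d (Fin.last N)) : RevLexLT m d :=
  ⟨_, h, fun q hq => absurd hq (Fin.le_last q).not_gt⟩

theorem RevLexLT.of_init {N : ℕ} {m d : Fin (N + 1) →₀ ℕ}
    (h : m (Fin.last N) = d (Fin.last N)) (h' : RevLexLT (initExp m) (initExp d)) :
    RevLexLT m d := by
  obtain ⟨p, h1, h2⟩ := h'
  refine ⟨p.castSucc, h1, fun q => ?_⟩
  refine Fin.lastCases (fun _ => h) (fun q hq => ?_) q
  exact h2 q (by simpa using hq)

/-- Since the last variable dominates the order, the leading exponent is read off the top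
coefficient in that variable. This lets leading terms be built one variable at a time. -/
theorem leads_eval₂_last {N : ℕ} {S : Type*} [CommRing S]
    (D : Polynomial (MvPolynomial (Fin N) S)) (a : ℕ) (hD : D.natDegree ≤ a)
    (d : Fin N →₀ ℕ) (h : Leads (D.coeff a) d) :
    Leads (D.eval₂ (rename Fin.castSucc : MvPolynomial (Fin N) S →ₐ[S] _).toRingHom
      (X (Fin.last N))) (snocExp d a) := by
  constructor
  · rw [coeff_eval₂_last]
    simpa using h.1
  · intro m hm
    rw [coeff_eval₂_last] at hm
    have hle : m (Fin.last N) ≤ a := by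
      by_contra hlt
      rw [Polynomial.coeff_eq_zero_of_natDegree_lt (by omega)] at hm
      simp at hm
    rcases hle.lt_or_eq with hlt | heq
    · exact Or.inr (RevLexLT.of_last (by simpa using hlt))
    · rw [heq] at hm
      rcases h.2 _ hm with h1 | h1
      · exact Or.inl ((eq_snocExp_iff _ _ _).2 ⟨h1, heq⟩)
      · exact Or.inr (RevLexLT.of_init (by simpa using heq) (by simpa using h1))

/-! ### Minors of remainder matrices -/

section Minors

variable {A : Type*} [CommRing A]

/-- The coefficients in the degrees `s j` of the remainders of `X ^ i * F` modulo `P`. -/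
noncomputable def remMatrix (P F : Polynomial A) (c : ℕ) (s : Fin (c + 1) → ℕ) :
    Matrix (Fin (c + 1)) (Fin (c + 1)) A :=
  Matrix.of fun i j => ((Polynomial.X ^ (i : ℕ) * F) %ₘ P).coeff (s j)

/-- The ideal generated by the maximal minors of the matrix of coefficients of the remainders of
`F, X * F, …, X ^ c * F` modulo `P`. -/
noncomputable def minorIdeal (P F : Polynomial A) (c : ℕ) : Ideal A :=
  Ideal.span (Set.range fun s : Fin (c + 1) → ℕ => (remMatrix P F c s).det)

theorem coeff_X_sub_C_mul_modByMonic (P F : Polynomial A) (y : A) (i s : ℕ) :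
    ((Polynomial.X ^ i * ((Polynomial.X - Polynomial.C y) * F)) %ₘ P).coeff s =
      ((Polynomial.X ^ (i + 1) * F) %ₘ P).coeff s - y * ((Polynomial.X ^ i * F) %ₘ P).coeff s := by
  have h : Polynomial.X ^ i * ((Polynomial.X - Polynomial.C y) * F) =
      Polynomial.X ^ (i + 1) * F - y • (Polynomial.X ^ i * F) := by
    rw [Polynomial.smul_eq_C_mul]; ring
  rw [h, Polynomial.sub_modByMonic, Polynomial.smul_modByMonic]
  simp

/-- Subtracting y times the previous row turns the rows of F, XF, … below the first into those of (X
- y)F, X(X - y)F, …; expansion along the first row leaves minors one size smaller. This is how a new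
variable enters with exponent zero. -/
theorem minorIdeal_succ_le (P F : Polynomial A) (y : A) (c : ℕ) :
    minorIdeal P F (c + 1) ≤ minorIdeal P ((Polynomial.X - Polynomial.C y) * F) c := by
  rw [minorIdeal, Ideal.span_le]
  rintro _ ⟨s, rfl⟩
  let B : Matrix (Fin (c + 2)) (Fin (c + 2)) A :=
    Matrix.of fun i j => Fin.cases ((F %ₘ P).coeff (s j))
      (fun i : Fin (c + 1) => ((Polynomial.X ^ (i : ℕ) *
        ((Polynomial.X - Polynomial.C y) * F)) %ₘ P).coeff (s j)) i
  have h : (remMatrix P F (c + 1) s).det = B.det := by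
    refine Matrix.det_eq_of_forall_row_eq_smul_add_pred (fun _ => y) ?_ ?_
    · intro j; simp [remMatrix, B]
    · intro i j
      simp [remMatrix, B, coeff_X_sub_C_mul_modByMonic]
  simp only [h, SetLike.mem_coe]
  rw [Matrix.det_succ_row_zero]
  refine Ideal.sum_mem _ fun j _ => Ideal.mul_mem_left _ _ (Ideal.subset_span ?_)
  exact ⟨fun l => s (j.succAbove l), rfl⟩

/-- A minor for (X - y)F of the same size is det(B - yM), where M holds the remainders of X^i F and
B those of X^(i+1) F. As a polynomial in y its top coefficient is det M up to sign. This is how a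
new variable enters with exponent c + 1. -/
theorem exists_polynomial_of_mem_minorIdeal {A' : Type*} [CommRing A'] (g : A' →+* A) (y : A)
    (P F : Polynomial A') (hP : P.Monic) (c : ℕ) (f : A') (hf : f ∈ minorIdeal P F c) :
    ∃ D : Polynomial A', D.natDegree ≤ c + 1 ∧ D.coeff (c + 1) = f ∧
      D.eval₂ g y ∈ minorIdeal (P.map g) ((Polynomial.X - Polynomial.C y) * F.map g) c := by
  induction hf using Submodule.span_induction with
  | zero => exact ⟨0, by simp⟩
  | add f₁ f₂ _ _ h₁ h₂ =>
    obtain ⟨D₁, a₁, b₁, c₁⟩ := h₁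
    obtain ⟨D₂, a₂, b₂, c₂⟩ := h₂
    exact ⟨D₁ + D₂, Polynomial.natDegree_add_le_of_degree_le a₁ a₂, by simp [b₁, b₂],
      by rw [Polynomial.eval₂_add]; exact add_mem c₁ c₂⟩
  | smul a f _ h =>
    obtain ⟨D, h1, h2, h3⟩ := h
    exact ⟨Polynomial.C a * D, (Polynomial.natDegree_C_mul_le _ _).trans h1, by simp [h2],
      by rw [Polynomial.eval₂_mul]; exact Ideal.mul_mem_left _ _ h3⟩
  | mem f hf =>
    obtain ⟨s, rfl⟩ := hf
    let M : Matrix (Fin (c + 1)) (Fin (c + 1)) A' := remMatrix P F c s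
    let B : Matrix (Fin (c + 1)) (Fin (c + 1)) A' :=
      Matrix.of fun i j => ((Polynomial.X ^ ((i : ℕ) + 1) * F) %ₘ P).coeff (s j)
    let D : Polynomial A' :=
      ((Polynomial.X : Polynomial A') • (-M).map Polynomial.C + B.map Polynomial.C).det
    -- The sign turns the top coefficient det(-M) into det M, so that leading coefficients stay
    -- equal to one.
    refine ⟨Polynomial.C ((-1) ^ (c + 1)) * D, ?_, ?_, ?_⟩
    · refine (Polynomial.natDegree_C_mul_le _ _).trans ?_
      simpa using Polynomial.natDegree_det_X_add_C_le (-M) B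
    · have h := Polynomial.coeff_det_X_add_C_card (-M) B
      rw [Fintype.card_fin] at h
      rw [Polynomial.coeff_C_mul, h, Matrix.det_neg, Fintype.card_fin, ← mul_assoc, ← mul_pow]
      simp [M]
    · rw [Polynomial.eval₂_mul]
      refine Ideal.mul_mem_left _ _ (Ideal.subset_span ⟨s, ?_⟩)
      have h : D.eval₂ g y = Polynomial.eval₂RingHom g y D := rfl
      rw [h, RingHom.map_det]
      refine congrArg Matrix.det (Matrix.ext fun i j => ?_)
      simp only [remMatrix, Matrix.of_apply, coeff_X_sub_C_mul_modByMonic, RingHom.mapMatrix_apply,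
        Matrix.map_apply, Matrix.add_apply, Matrix.smul_apply, Matrix.neg_apply, M, B,
        smul_eq_mul, Polynomial.coe_eval₂RingHom, Polynomial.eval₂_add, Polynomial.eval₂_mul,
        Polynomial.eval₂_C, Polynomial.eval₂_X, map_neg, mul_neg, Polynomial.eval₂_neg]
      have h2 : ∀ l : ℕ, (Polynomial.X ^ l * F.map g) %ₘ (P.map g) =
          ((Polynomial.X ^ l * F) %ₘ P).map g := by
        intro l
        rw [Polynomial.map_modByMonic _ hP]
        simp
      rw [h2, h2, Polynomial.coeff_map, Polynomial.coeff_map]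
      ring

/-- The powers 1, X, …, X^c are their own remainders, so the columns of degrees 0, …, c form the
identity matrix. -/
theorem one_mem_minorIdeal [Nontrivial A] (P : Polynomial A) (hP : P.Monic) (c : ℕ)
    (hc : c < P.natDegree) : (1 : A) ∈ minorIdeal P 1 c := by
  refine Ideal.subset_span ⟨fun j => j, ?_⟩
  have h : remMatrix P 1 c (fun j => (j : ℕ)) = 1 := by
    ext i j
    rw [remMatrix, Matrix.of_apply, mul_one, (Polynomial.modByMonic_eq_self_iff hP).2,
      Polynomial.coeff_X_pow, Matrix.one_apply]
    · simp [Fin.ext_iff, eq_comm]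
    · rw [Polynomial.degree_X_pow, Polynomial.degree_eq_natDegree hP.ne_zero]
      exact_mod_cast lt_of_le_of_lt (Nat.lt_succ_iff.1 i.2) hc
  simp only [h, Matrix.det_one]

end Minors

/-! ### Leading terms from the remainder generators -/

/-- The polynomial with the roots `x₁, …, x_N`. -/
noncomputable def genericProd (N : ℕ) (S : Type*) [CommRing S] :
    Polynomial (MvPolynomial (Fin N) S) :=
  ∏ i : Fin N, (Polynomial.X - Polynomial.C (X i))

theorem genericProd_succ (N : ℕ) (S : Type*) [CommRing S] :
    genericProd (N + 1) S = (Polynomial.X - Polynomial.C (X (Fin.last N))) *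
      (genericProd N S).map (rename Fin.castSucc : MvPolynomial (Fin N) S →ₐ[S] _).toRingHom := by
  rw [genericProd, Fin.prod_univ_castSucc, mul_comm, genericProd, Polynomial.map_prod]
  simp

/-- The induction follows `skipCount`. If the last entry is at most the state c, the variable is
given exponent 0 and the minors grow by one; otherwise it is given exponent c + 1 and the size is
kept. When no variables remain, the final state is below the degree of P and the minor ideal
contains 1. -/
theorem exists_leads_of_skipCount_lt {S : Type*} [CommRing S] [Nontrivial S] (P : Polynomial S)
    (hP : P.Monic) : ∀ (N : ℕ) (e : Fin N → ℕ) (c : ℕ), skipCount N e c < P.natDegree →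
      ∃ f ∈ minorIdeal (P.map C) (genericProd N S) c, ∃ d, (∀ i, d i ≤ e i) ∧ Leads f d := by
  intro N
  induction N with
  | zero =>
    intro e c h
    refine ⟨1, ?_, 0, fun i => i.elim0, ?_, ?_⟩
    · have h1 : genericProd 0 S = 1 := by simp [genericProd]
      rw [h1]
      refine one_mem_minorIdeal _ (hP.map _) c ?_
      rw [hP.natDegree_map]
      exact h
    · simp
    · intro m _
      exact Or.inl (Subsingleton.elim _ _)
  | succ N ih =>
    intro e c h
    set g := (rename Fin.castSucc : MvPolynomial (Fin N) S →ₐ[S] _).toRingHom with hg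
    have hmap : (P.map C).map g = P.map C := by
      rw [Polynomial.map_map]
      congr 1
      ext a
      simp [hg]
    rw [genericProd_succ, ← hg]
    rw [skipCount] at h
    split_ifs at h with h0
    · obtain ⟨f, hf, d, hd, hl⟩ := ih _ _ h
      refine ⟨g f, ?_, snocExp d 0, ?_, ?_⟩
      · refine minorIdeal_succ_le _ _ _ _ ?_
        have h1 : Ideal.map g (minorIdeal (P.map C) (genericProd N S) (c + 1)) ≤
            minorIdeal (P.map C) ((genericProd N S).map g) (c + 1) := by
          rw [minorIdeal, Ideal.map_span, Ideal.span_le]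
          rintro _ ⟨_, ⟨s, rfl⟩, rfl⟩
          refine Ideal.subset_span ⟨s, ?_⟩
          simp only [RingHom.map_det]
          congr 1
          ext i j
          rw [RingHom.mapMatrix_apply, Matrix.map_apply, remMatrix, remMatrix, Matrix.of_apply,
            Matrix.of_apply, ← Polynomial.coeff_map, Polynomial.map_modByMonic _ (hP.map _), hmap]
          simp
        exact h1 (Ideal.mem_map_of_mem _ hf)
      · intro i
        refine Fin.lastCases ?_ (fun i => ?_) i
        · simp
        · simpa using hd i
      · have h1 := leads_eval₂_last (Polynomial.C f) 0 (by simp) d (by simpa using hl)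
        rwa [Polynomial.eval₂_C] at h1
    · obtain ⟨f, hf, d, hd, hl⟩ := ih _ _ h
      obtain ⟨D, h1, h2, h3⟩ := exists_polynomial_of_mem_minorIdeal g (X (Fin.last N)) _ _
        (hP.map _) c f hf
      rw [hmap] at h3
      refine ⟨_, h3, snocExp d (c + 1), ?_, leads_eval₂_last D (c + 1) h1 d (by rwa [h2])⟩
      intro i
      refine Fin.lastCases ?_ (fun i => ?_) i
      · simpa using h0
      · simpa using hd i

/-! ### Generating series of complete homogeneous polynomials -/

/-- The geometric series `∑ x ^ d u ^ d`. -/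
noncomputable def geomSeries {A : Type*} [CommRing A] (x : A) : PowerSeries A :=
  PowerSeries.mk fun d => x ^ d

theorem geomSeries_mul_one_sub {A : Type*} [CommRing A] (x : A) :
    geomSeries x * (1 - PowerSeries.C x * PowerSeries.X) = 1 := by
  ext d
  rw [mul_sub, mul_one, ← mul_assoc, map_sub]
  cases d with
  | zero => simp [geomSeries]
  | succ d =>
    rw [PowerSeries.coeff_succ_mul_X, PowerSeries.coeff_mul_C]
    simp [geomSeries, PowerSeries.coeff_one, pow_succ]

theorem map_geomSeries {A B : Type*} [CommRing A] [CommRing B] (g : A →+* B) (x : A) :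
    (geomSeries x).map g = geomSeries (g x) := by
  ext d; simp [geomSeries]

theorem coeff_prod_geomSeries {A ι : Type*} [CommRing A] [DecidableEq ι] (s : Finset ι)
    (x : ι → A) (d : ℕ) :
    PowerSeries.coeff d (∏ j ∈ s, geomSeries (x j)) =
      ∑ l ∈ s.finsuppAntidiag d, ∏ j ∈ s, x j ^ l j := by
  simp [PowerSeries.coeff_prod, geomSeries]

/-- Multisets of size d correspond to exponent vectors of total degree d; this passes from Mathlib's
sum over multisets to the product of geometric series. -/
theorem aeval_hsymm {S A ι : Type*} [CommRing S] [CommRing A] [Algebra S A] [Fintype ι]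
    [DecidableEq ι] (x : ι → A) (d : ℕ) :
    aeval x (hsymm ι S d) = PowerSeries.coeff d (∏ j, geomSeries (x j)) := by
  rw [coeff_prod_geomSeries, hsymm, map_sum]
  refine Finset.sum_bij (fun s _ => Multiset.toFinsupp (s : Multiset ι)) ?_ ?_ ?_ ?_
  · intro s _
    rw [Finset.mem_finsuppAntidiag]
    refine ⟨?_, Finset.subset_univ _⟩
    exact (Multiset.sum_count_eq_card (s := Finset.univ) (m := (s : Multiset ι))
      fun a _ => Finset.mem_univ a).trans s.2
  · intro s _ t _ h
    exact Sym.coe_injective (Multiset.toFinsupp.injective h)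
  · intro l hl
    rw [Finset.mem_finsuppAntidiag] at hl
    refine ⟨⟨Finsupp.toMultiset l, ?_⟩, Finset.mem_univ _, ?_⟩
    · rw [Finsupp.card_toMultiset, Finsupp.sum_fintype _ _ (by simp)]
      exact hl.1
    · simp
  · intro s _
    rw [map_multiset_prod, Multiset.map_map, Finset.prod_multiset_map_count]
    simp only [Function.comp_apply, aeval_X, Multiset.toFinsupp_apply]
    refine Finset.prod_subset (Finset.subset_univ _) fun j _ hj => ?_
    rw [Multiset.count_eq_zero_of_notMem (by simpa using hj), pow_zero]

theorem prod_X_pow_comp_eq_monomial {S ι σ : Type*} [CommRing S] (s : Finset ι) (v : ι → σ) (l : ι → ℕ) :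
    ∏ j ∈ s, (X (v j) : MvPolynomial σ S) ^ l j =
      monomial (∑ j ∈ s, Finsupp.single (v j) (l j)) 1 := by
  classical
  induction s using Finset.induction_on with
  | empty => simp
  | insert a s ha ih =>
    rw [Finset.prod_insert ha, Finset.sum_insert ha, ih, X_pow_eq_monomial, monomial_mul, one_mul]

theorem sum_single_apply_of_injective {ι σ : Type*} (s : Finset ι) (v : ι → σ)
    (hv : Function.Injective v) (l : ι → ℕ) {j : ι} (hj : j ∈ s) :
    (∑ j ∈ s, Finsupp.single (v j) (l j)) (v j) = l j := by
  rw [Finsupp.finsetSum_apply, Finset.sum_eq_single j]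
  · simp
  · intro a _ ha
    exact Finsupp.single_eq_of_ne (fun h => ha (hv h.symm))
  · exact fun h => absurd hj h

theorem of_coeff_prod_geomSeries_ne_zero {S ι σ : Type*} [CommRing S] [DecidableEq ι]
    (s : Finset ι) (v : ι → σ) (hv : Function.Injective v) (d : ℕ) (m : σ →₀ ℕ)
    (h : coeff m (PowerSeries.coeff d (∏ j ∈ s, geomSeries (X (v j) : MvPolynomial σ S))) ≠ 0) :
    (∀ q, (∀ j ∈ s, v j ≠ q) → m q = 0) ∧ ∑ j ∈ s, m (v j) = d := by
  rw [coeff_prod_geomSeries, coeff_sum] at h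
  obtain ⟨l, hl, h1⟩ := Finset.exists_ne_zero_of_sum_ne_zero h
  classical
  rw [prod_X_pow_comp_eq_monomial, coeff_monomial] at h1
  have h2 : ∑ j ∈ s, Finsupp.single (v j) (l j) = m := by
    by_contra h3
    exact h1 (if_neg h3)
  rw [Finset.mem_finsuppAntidiag] at hl
  constructor
  · intro q hq
    rw [← h2, Finsupp.finsetSum_apply]
    exact Finset.sum_eq_zero fun j hj => Finsupp.single_eq_of_ne (hq j hj).symm
  · rw [← hl.1]
    refine Finset.sum_congr rfl fun j hj => ?_
    rw [← h2, sum_single_apply_of_injective s v hv l hj]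

theorem coeff_single_prod_geomSeries {S ι σ : Type*} [CommRing S] [DecidableEq ι]
    (s : Finset ι) (v : ι → σ) (hv : Function.Injective v) (d : ℕ) {j₀ : ι} (hj₀ : j₀ ∈ s) :
    coeff (Finsupp.single (v j₀) d)
      (PowerSeries.coeff d (∏ j ∈ s, geomSeries (X (v j) : MvPolynomial σ S))) = 1 := by
  classical
  rw [coeff_prod_geomSeries, coeff_sum, Finset.sum_eq_single (Finsupp.single j₀ d)]
  · rw [prod_X_pow_comp_eq_monomial, coeff_monomial, if_pos]
    rw [Finset.sum_eq_single j₀]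
    · simp
    · intro j _ hj
      rw [Finsupp.single_eq_of_ne hj, Finsupp.single_zero]
    · exact fun h => absurd hj₀ h
  · intro l hl hne
    rw [prod_X_pow_comp_eq_monomial, coeff_monomial, if_neg]
    intro h
    apply hne
    rw [Finset.mem_finsuppAntidiag] at hl
    ext j
    by_cases hj : j ∈ s
    · rw [← sum_single_apply_of_injective s v hv l hj, h]
      by_cases hjj : j = j₀
      · subst hjj; simp
      · rw [Finsupp.single_eq_of_ne (fun h => hjj (hv h)), Finsupp.single_eq_of_ne hjj]
    · rw [Finsupp.notMem_support_iff.1 fun h => hj (hl.2 h),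
        Finsupp.single_eq_of_ne (by rintro rfl; exact hj hj₀)]
  · intro h
    exfalso
    apply h
    rw [Finset.mem_finsuppAntidiag]
    constructor
    · rw [Finset.sum_eq_single j₀]
      · simp
      · intro j _ hj
        exact Finsupp.single_eq_of_ne hj
      · exact fun h => absurd hj₀ h
    · intro j hj
      have h1 := Finsupp.support_single_subset hj
      rw [Finset.mem_singleton] at h1
      exact h1 ▸ hj₀

/-! ### The deformed ideal and spanning by standard monomials -/

section Deformation

variable {r k : ℕ} {S : Type*} [CommRing S]

/-- The polynomial `∏ (T - z_b)`. -/
noncomputable def blockPoly (z : Fin k → S) : Polynomial S :=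
  ∏ b, (Polynomial.X - Polynomial.C (z b))

/-- The power series `∏ (1 - z_b u)`. -/
noncomputable def blockSeries (z : Fin k → S) : PowerSeries S :=
  ∏ b, (1 - PowerSeries.C (z b) * PowerSeries.X)

theorem blockPoly_monic (z : Fin k → S) : (blockPoly z).Monic :=
  Polynomial.monic_prod_of_monic _ _ fun _ _ => Polynomial.monic_X_sub_C _

theorem natDegree_blockPoly [Nontrivial S] (z : Fin k → S) : (blockPoly z).natDegree = k := by
  rw [blockPoly, Polynomial.natDegree_prod_of_monic _ _ fun _ _ => Polynomial.monic_X_sub_C _]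
  simp

theorem map_blockPoly {S' : Type*} [CommRing S'] (g : S →+* S') (z : Fin k → S) :
    (blockPoly z).map g = blockPoly (g ∘ z) := by
  simp [blockPoly, Polynomial.map_prod]

theorem map_blockSeries {S' : Type*} [CommRing S'] (g : S →+* S') (z : Fin k → S) :
    (blockSeries z).map g = blockSeries (g ∘ z) := by
  simp [blockSeries, map_prod]

/-- The generating series of the complete homogeneous symmetric polynomials in the first `l`
variables of the `i`-th batch. -/
noncomputable def batchSeries (α : Fin r → ℕ) (S : Type*) [CommRing S] (i : Fin r) (l : ℕ) :
    PowerSeries (MvPolynomial (Fin (compSize α)) S) :=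
  ∏ j ∈ Finset.univ.filter (fun j : Fin (α i) => (j : ℕ) < l), geomSeries (X (batchIndex α i j))

/-- The deformation of the ideal `I_{α,k}` with the parameters `z`. -/
noncomputable def deformedIdeal (α : Fin r → ℕ) (z : Fin k → S) :
    Ideal (MvPolynomial (Fin (compSize α)) S) :=
  Ideal.span
    ({f | ∃ d < k, f = (genericProd (compSize α) S %ₘ (blockPoly z).map C).coeff d} ∪
     {f | ∃ (i : Fin r) (d : ℕ), k + 1 ≤ d + α i ∧ d ≤ k ∧
        f = PowerSeries.coeff d ((blockSeries z).map C * batchSeries α S i (α i))})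

theorem map_genericProd {S' : Type*} [CommRing S'] (g : S →+* S') (N : ℕ) :
    (genericProd N S).map (MvPolynomial.map g) = genericProd N S' := by
  simp [genericProd, Polynomial.map_prod]

theorem map_batchSeries {S' : Type*} [CommRing S'] (g : S →+* S') (α : Fin r → ℕ) (i : Fin r)
    (l : ℕ) : (batchSeries α S i l).map (MvPolynomial.map g) = batchSeries α S' i l := by
  simp [batchSeries, map_prod, map_geomSeries]

theorem map_comp_C_eq_C_comp {σ S' : Type*} [CommRing S'] (g : S →+* S') :
    (MvPolynomial.map g : MvPolynomial σ S →+* _).comp C = C.comp g := by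
  ext a; simp

theorem map_deformedIdeal {S' : Type*} [CommRing S'] (g : S →+* S') (α : Fin r → ℕ)
    (z : Fin k → S) :
    (deformedIdeal α z).map (MvPolynomial.map g) = deformedIdeal α (g ∘ z) := by
  have h1 : ∀ d, MvPolynomial.map g
      ((genericProd (compSize α) S %ₘ (blockPoly z).map C).coeff d) =
      (genericProd (compSize α) S' %ₘ (blockPoly (g ∘ z)).map C).coeff d := by
    intro d
    rw [← Polynomial.coeff_map, Polynomial.map_modByMonic _ ((blockPoly_monic z).map _),
      map_genericProd, Polynomial.map_map, map_comp_C_eq_C_comp, ← map_blockPoly,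
      Polynomial.map_map]
  have h2 : ∀ (i : Fin r) (d : ℕ), MvPolynomial.map g
      (PowerSeries.coeff d ((blockSeries z).map C * batchSeries α S i (α i))) =
      PowerSeries.coeff d ((blockSeries (g ∘ z)).map C * batchSeries α S' i (α i)) := by
    intro i d
    rw [← PowerSeries.coeff_map, map_mul, map_batchSeries, ← map_blockSeries]
    congr 2
    ext e : 1
    simp
  rw [deformedIdeal, deformedIdeal, Ideal.map_span, Set.image_union]
  congr 2
  · ext f
    constructor
    · rintro ⟨_, ⟨d, hd, rfl⟩, rfl⟩
      exact ⟨d, hd, h1 d⟩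
    · rintro ⟨d, hd, rfl⟩
      exact ⟨_, ⟨d, hd, rfl⟩, h1 d⟩
  · ext f
    constructor
    · rintro ⟨_, ⟨i, d, h3, h4, rfl⟩, rfl⟩
      exact ⟨i, d, h3, h4, h2 i d⟩
    · rintro ⟨i, d, h3, h4, rfl⟩
      exact ⟨_, ⟨i, d, h3, h4, rfl⟩, h2 i d⟩

theorem batchSeries_all (α : Fin r → ℕ) (i : Fin r) :
    batchSeries α S i (α i) = ∏ j, geomSeries (X (batchIndex α i j)) := by
  rw [batchSeries, Finset.filter_true_of_mem fun j _ => j.2]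

theorem batchHsymm_eq (α : Fin r → ℕ) (i : Fin r) (d : ℕ) :
    batchHsymm α i d = PowerSeries.coeff d (batchSeries α ℤ i (α i)) := by
  rw [batchSeries_all, batchHsymm, ← aeval_hsymm (S := ℤ),
    rename_eq_aeval]
  rfl

theorem coeff_genericProd (N d : ℕ) (hd : d ≤ N) :
    (genericProd N S).coeff d = (-1) ^ (N - d) * esymm (Fin N) S (N - d) := by
  have h := Multiset.prod_X_sub_C_coeff
    ((Finset.univ : Finset (Fin N)).val.map fun i => (X i : MvPolynomial (Fin N) S)) (k := d)
    (by simpa using hd)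
  rw [Multiset.map_map, Multiset.card_map, Finset.card_val, Finset.card_univ, Fintype.card_fin] at h
  rw [genericProd, esymm_eq_multiset_esymm]
  exact h

theorem coeff_modByMonic_X_pow {A : Type*} [CommRing A] (F : Polynomial A) (k d : ℕ) (hd : d < k) :
    (F %ₘ (Polynomial.X ^ k)).coeff d = F.coeff d := by
  have h := congrArg (fun p => Polynomial.coeff p d)
    (Polynomial.modByMonic_add_div F (Polynomial.X ^ k))
  rw [← h]
  simp [Polynomial.coeff_X_pow_mul', hd.not_ge]

/-- The remainder modulo T^k keeps exactly the coefficients of degree d < k, which are the e_{n-d}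
up to sign, and the series ∏(1 - z_b u) becomes 1. -/
theorem deformedIdeal_zero (α : Fin r → ℕ) (k : ℕ) :
    deformedIdeal α (0 : Fin k → ℤ) = idealI α k := by
  have hP : (blockPoly (0 : Fin k → ℤ)).map (C : ℤ →+* MvPolynomial (Fin (compSize α)) ℤ) =
      Polynomial.X ^ k := by simp [blockPoly]
  have hB : blockSeries (0 : Fin k → ℤ) = 1 := by simp [blockSeries]
  rw [deformedIdeal, idealI, hP, hB, map_one]
  simp only [one_mul, batchHsymm_eq]
  rw [Ideal.span_union, Ideal.span_union]
  congr 1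
  apply le_antisymm <;> rw [Ideal.span_le]
  · rintro _ ⟨d, hd, rfl⟩
    rw [coeff_modByMonic_X_pow _ _ _ hd]
    rcases le_or_gt d (compSize α) with h | h
    · rw [coeff_genericProd _ _ h]
      exact Ideal.mul_mem_left _ _ (Ideal.subset_span ⟨_, by omega, by omega, rfl⟩)
    · rw [Polynomial.coeff_eq_zero_of_natDegree_lt]
      · exact zero_mem _
      · refine lt_of_le_of_lt (Polynomial.natDegree_prod_le _ _) ?_
        simpa using h
  · rintro _ ⟨d, h1, h2, rfl⟩
    have h : esymm (Fin (compSize α)) ℤ d = (-1) ^ d *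
        (genericProd (compSize α) ℤ %ₘ Polynomial.X ^ k).coeff (compSize α - d) := by
      rw [coeff_modByMonic_X_pow _ _ _ (by omega), coeff_genericProd _ _ (by omega),
        Nat.sub_sub_self h2, ← mul_assoc, ← mul_pow]
      simp
    rw [h]
    exact Ideal.mul_mem_left _ _ (Ideal.subset_span ⟨_, by omega, rfl⟩)

theorem batchSeries_succ_mul (α : Fin r → ℕ) (i : Fin r) (j : Fin (α i)) :
    batchSeries α S i (j + 1) *
      (1 - PowerSeries.C (X (batchIndex α i j)) * PowerSeries.X) = batchSeries α S i j := by
  have h : Finset.univ.filter (fun l : Fin (α i) => (l : ℕ) < j + 1) =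
      insert j (Finset.univ.filter fun l : Fin (α i) => (l : ℕ) < j) := by
    ext l
    simp [Fin.ext_iff]
    omega
  rw [batchSeries, h, Finset.prod_insert (by simp), mul_right_comm, geomSeries_mul_one_sub,
    one_mul, batchSeries]

/-- Dropping one variable x multiplies the series by 1 - xu, so a coefficient for l variables
combines those of degrees d and d - 1 for l + 1 variables. The range of admissible degrees thus
shrinks by one for each variable dropped. -/
theorem coeff_batchSeries_mem (α : Fin r → ℕ) (z : Fin k → S) (i : Fin r) :
    ∀ (t l d : ℕ), l + t = α i → k + 1 ≤ d + l → d ≤ k →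
      PowerSeries.coeff d ((blockSeries z).map C * batchSeries α S i l) ∈ deformedIdeal α z := by
  intro t
  induction t with
  | zero =>
    intro l d h1 h2 h3
    obtain rfl : l = α i := by omega
    exact Ideal.subset_span (Or.inr ⟨i, d, h2, h3, rfl⟩)
  | succ t ih =>
    intro l d h1 h2 h3
    have h := batchSeries_succ_mul (S := S) α i ⟨l, by omega⟩
    rw [← h, ← mul_assoc, mul_sub, mul_one, map_sub]
    refine sub_mem (ih _ _ (by simp; omega) (by simp; omega) h3) ?_
    rw [← mul_assoc]
    cases d with
    | zero => simp
    | succ d =>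
      rw [PowerSeries.coeff_succ_mul_X, PowerSeries.coeff_mul_C]
      exact Ideal.mul_mem_right _ _ (ih _ _ (by simp; omega) (by simp; omega) (by omega))

theorem batchIndex_lt_iff (α : Fin r → ℕ) (i : Fin r) (j l : Fin (α i)) :
    batchIndex α i j < batchIndex α i l ↔ j < l := by
  rw [Fin.lt_def, batchIndex_val, batchIndex_val, Fin.lt_def]
  omega

/-- Among the terms of total degree at most d in the first variables of a batch, the d-th power of
the last of these variables is the largest. The constant coefficient of B makes its coefficient one.
-/
theorem leads_coeff_batchSeries (α : Fin r → ℕ) (B : PowerSeries S)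
    (hB : PowerSeries.constantCoeff B = 1) (i : Fin r) (j : Fin (α i)) (d : ℕ) :
    Leads (PowerSeries.coeff d (B.map C * batchSeries α S i (j + 1)))
      (Finsupp.single (batchIndex α i j) d) := by
  have hmem : j ∈ Finset.univ.filter (fun l : Fin (α i) => (l : ℕ) < j + 1) := by simp
  have hinj := batchIndex_injective α i
  rw [PowerSeries.coeff_mul]
  simp only [PowerSeries.coeff_map]
  constructor
  · rw [coeff_sum, Finset.sum_eq_single (0, d)]
    · rw [coeff_C_mul, batchSeries, coeff_single_prod_geomSeries _ _ hinj _ hmem]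
      simpa using hB
    · rintro ⟨a, b⟩ hab hne
      rw [coeff_C_mul]
      by_contra h
      have h1 := (of_coeff_prod_geomSeries_ne_zero _ _ hinj _ _ (right_ne_zero_of_mul h)).2
      rw [Finset.sum_eq_single j] at h1
      · simp only [Finsupp.single_eq_same] at h1
        rw [Finset.HasAntidiagonal.mem_antidiagonal] at hab
        simp only at hab h1
        exact hne (Prod.ext (by simp; omega) h1.symm)
      · intro l _ hl
        exact Finsupp.single_eq_of_ne fun h => hl (hinj h)
      · exact fun h => absurd hmem h
    · intro h
      simp at h
  · intro m hm
    rw [coeff_sum] at hm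
    obtain ⟨⟨a, b⟩, hab, h⟩ := Finset.exists_ne_zero_of_sum_ne_zero hm
    rw [coeff_C_mul] at h
    obtain ⟨h1, h2⟩ := of_coeff_prod_geomSeries_ne_zero _ _ hinj _ _ (right_ne_zero_of_mul h)
    rw [Finset.HasAntidiagonal.mem_antidiagonal] at hab
    simp only at hab h2
    have hle := Finset.single_le_sum (f := fun l => m (batchIndex α i l))
      (fun _ _ => Nat.zero_le _) hmem
    rcases (show m (batchIndex α i j) ≤ d by omega).lt_or_eq with hlt | heq
    · refine Or.inr ⟨batchIndex α i j, by simpa using hlt, fun q hq => ?_⟩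
      rw [Finsupp.single_eq_of_ne hq.ne', h1]
      rintro l hl rfl
      rw [batchIndex_lt_iff, Fin.lt_def] at hq
      simp at hl
      omega
    · left
      ext q
      by_cases hq : q = batchIndex α i j
      · rw [hq, heq, Finsupp.single_eq_same]
      · rw [Finsupp.single_eq_of_ne hq]
        by_cases hs : ∃ l ∈ Finset.univ.filter (fun l : Fin (α i) => (l : ℕ) < j + 1),
            batchIndex α i l = q
        · obtain ⟨l, hl, rfl⟩ := hs
          have hne : l ≠ j := fun h => hq (by rw [h])
          have h3 := Finset.add_le_sum (f := fun l => m (batchIndex α i l))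
            (fun _ _ => Nat.zero_le _) hl hmem hne
          omega
        · push Not at hs
          exact h1 q hs

/-- The exponent vectors of the monomials that no leading monomial found in
`exists_leads_mem_deformedIdeal` divides. -/
def standardExps (α : Fin r → ℕ) (k : ℕ) : Set (Fin (compSize α) →₀ ℕ) :=
  {m | k ≤ skipCount (compSize α) m 0 ∧
    ∀ (i : Fin r) (j : Fin (α i)), m (batchIndex α i j) < k - (j : ℕ)}

theorem constantCoeff_blockSeries (z : Fin k → S) :
    PowerSeries.constantCoeff (blockSeries z) = 1 := by
  simp [blockSeries, map_prod]

theorem exists_leads_mem_deformedIdeal [Nontrivial S] (α : Fin r → ℕ) (z : Fin k → S)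
    (m : Fin (compSize α) →₀ ℕ) (hm : m ∉ standardExps α k) :
    ∃ f ∈ deformedIdeal α z, ∃ d, d ≤ m ∧ Leads f d := by
  by_cases h : k ≤ skipCount (compSize α) m 0
  · have h1 : ∃ (i : Fin r) (j : Fin (α i)), k - (j : ℕ) ≤ m (batchIndex α i j) := by
      by_contra h2
      push Not at h2
      exact hm ⟨h, h2⟩
    obtain ⟨i, j, hij⟩ := h1
    -- The first j + 1 variables in degree k - j: the lowest degree admissible for that many
    -- variables, hence the smallest pure power obtained.
    refine ⟨_, coeff_batchSeries_mem α z i (α i - (j + 1)) (j + 1) (k - j) ?_ ?_ ?_, _, ?_,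
      leads_coeff_batchSeries α _ (constantCoeff_blockSeries z) i j _⟩
    · have := j.2; omega
    · omega
    · omega
    · intro q
      by_cases hq : q = batchIndex α i j
      · rw [hq, Finsupp.single_eq_same]; exact hij
      · rw [Finsupp.single_eq_of_ne hq]; exact Nat.zero_le _
  · obtain ⟨f, hf, d, hd, hl⟩ := exists_leads_of_skipCount_lt (blockPoly z) (blockPoly_monic z)
      (compSize α) m 0 (by rw [natDegree_blockPoly]; omega)
    refine ⟨f, ?_, d, hd, hl⟩
    refine (?_ : minorIdeal _ _ 0 ≤ _) hf
    rw [minorIdeal, Ideal.span_le]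
    rintro _ ⟨s, rfl⟩
    simp only [SetLike.mem_coe]
    have hs0 : (remMatrix ((blockPoly z).map C) (genericProd (compSize α) S) 0 s).det =
        (genericProd (compSize α) S %ₘ (blockPoly z).map C).coeff (s 0) := by
      rw [Matrix.det_fin_one]
      simp [remMatrix]
    rw [hs0]
    rcases lt_or_ge (s 0) k with hs | hs
    · exact Ideal.subset_span (Or.inl ⟨_, hs, rfl⟩)
    · have hd := Polynomial.degree_modByMonic_lt (genericProd (compSize α) S)
        ((blockPoly_monic z).map (C : S →+* MvPolynomial (Fin (compSize α)) S))
      rw [Polynomial.coeff_eq_zero_of_degree_lt]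
      · exact zero_mem _
      · refine hd.trans_le ?_
        refine Polynomial.degree_map_le.trans (Polynomial.degree_le_natDegree.trans ?_)
        rw [natDegree_blockPoly]
        exact_mod_cast hs

/-- Division with remainder: a monomial outside M is replaced by smaller ones through a multiple of
f. Leading coefficients equal to one make this valid over any commutative ring, in particular over ℤ
and ℤ[t]. -/
theorem monomial_mem_span_sup {N : ℕ} (I : Ideal (MvPolynomial (Fin N) S))
    (M : Set (Fin N →₀ ℕ)) (h : ∀ m ∉ M, ∃ f ∈ I, ∃ d, d ≤ m ∧ Leads f d) (m : Fin N →₀ ℕ) :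
    monomial m (1 : S) ∈
      Submodule.span S ((fun m => monomial m (1 : S)) '' M) ⊔ I.restrictScalars S := by
  induction m using (wellFounded_revLexLT N).induction with
  | _ m ih =>
    by_cases hm : m ∈ M
    · exact Submodule.mem_sup_left (Submodule.subset_span ⟨m, hm, rfl⟩)
    obtain ⟨f, hf, d, hd, hl⟩ := h m hm
    obtain ⟨c, rfl⟩ := exists_add_of_le hd
    have h1 : monomial c (1 : S) * f ∈ I.restrictScalars S := Ideal.mul_mem_left _ _ hf
    have h2 : monomial c (1 : S) * f =
        ∑ s ∈ f.support, coeff s f • monomial (c + s) (1 : S) := by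
      conv_lhs => rw [f.as_sum, Finset.mul_sum]
      refine Finset.sum_congr rfl fun s _ => ?_
      rw [monomial_mul, smul_monomial, one_mul, smul_eq_mul, mul_one]
    by_cases hd0 : d ∈ f.support
    · rw [← Finset.add_sum_erase _ _ hd0, hl.1, one_smul, add_comm c d] at h2
      rw [eq_sub_of_add_eq h2.symm]
      refine sub_mem (Submodule.mem_sup_right h1) (Submodule.sum_mem _ fun s hs => ?_)
      rw [Finset.mem_erase, mem_support_iff] at hs
      refine Submodule.smul_mem _ _ (ih _ ?_)
      rw [add_comm d c]
      exact ((hl.2 s hs.2).resolve_left hs.1).add_left c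
    -- The leading coefficient is one, so an exponent outside the support forces the trivial ring.
    · have h3 : (1 : S) = 0 := by
        rw [← hl.1]
        simpa using hd0
      rw [h3, monomial_zero]
      exact zero_mem _

theorem mem_span_standard_sup [Nontrivial S] (α : Fin r → ℕ) (z : Fin k → S)
    (f : MvPolynomial (Fin (compSize α)) S) :
    f ∈ Submodule.span S ((fun m => monomial m (1 : S)) '' standardExps α k) ⊔
      (deformedIdeal α z).restrictScalars S := by
  rw [f.as_sum]
  refine Submodule.sum_mem _ fun m _ => ?_
  rw [← mul_one (coeff m f), ← smul_eq_mul, ← smul_monomial]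
  exact Submodule.smul_mem _ _ (monomial_mem_span_sup _ _
    (fun m hm => exists_leads_mem_deformedIdeal α z m hm) m)

end Deformation

/-! ### Counting standard monomials -/

/-- The polynomial `∏_{s < c} (1 - X / (s + 1))`. -/
noncomputable def skipPoly (c : ℕ) : Polynomial ℚ :=
  ∏ s ∈ Finset.range c, (1 - Polynomial.C ((s + 1 : ℚ)⁻¹) * Polynomial.X)

theorem skipPoly_zero : skipPoly 0 = 1 := by simp [skipPoly]

theorem skipPoly_succ_eval (c : ℕ) (x : ℚ) :
    (c + 1) * (skipPoly (c + 1)).eval x = (c + 1 - x) * (skipPoly c).eval x := by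
  rw [skipPoly, Finset.prod_range_succ, ← skipPoly]
  have h : (c + 1 : ℚ) ≠ 0 := by positivity
  simp only [Polynomial.eval_mul, Polynomial.eval_sub, Polynomial.eval_one, Polynomial.eval_C,
    Polynomial.eval_X]
  field_simp

theorem skipPoly_eval_zero (c : ℕ) : (skipPoly c).eval 0 = 1 := by
  simp [skipPoly, Polynomial.eval_prod]

theorem skipPoly_eval_eq_zero (c i : ℕ) (h1 : 1 ≤ i) (h2 : i ≤ c) :
    (skipPoly c).eval (i : ℚ) = 0 := by
  rw [skipPoly, Polynomial.eval_prod]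
  refine Finset.prod_eq_zero (i := i - 1) (by simp; omega) ?_
  have h : (i : ℚ) ≠ 0 := by positivity
  have h3 : ((i - 1 : ℕ) : ℚ) + 1 = i := by
    rw [Nat.cast_sub h1]; simp
  simp [h3, h]

theorem natDegree_skipPoly_le (c : ℕ) : (skipPoly c).natDegree ≤ c := by
  refine (Polynomial.natDegree_prod_le _ _).trans ?_
  refine (Finset.sum_le_card_nsmul _ _ 1 fun s _ => ?_).trans (by simp)
  refine (Polynomial.natDegree_sub_le _ _).trans ?_
  simpa using (Polynomial.natDegree_C_mul_le ((s + 1 : ℚ)⁻¹) Polynomial.X).trans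
    Polynomial.natDegree_X_le

/-- For k ≤ c all terms vanish except i = 0. For k > c the sum is, up to sign, a k-th finite
difference of a polynomial of degree less than k. The identity turns the condition k ≤ `skipCount`
into an alternating sum whose terms factor. -/
theorem sum_choose_skipPoly (k c : ℕ) :
    ∑ i ∈ Finset.range (k + 1), (-1 : ℚ) ^ i * k.choose i * (skipPoly c).eval (i : ℚ) =
      if k ≤ c then 1 else 0 := by
  split_ifs with h
  · rw [Finset.sum_eq_single 0]
    · simp [skipPoly_eval_zero]
    · intro i hi h0
      rw [Finset.mem_range] at hi
      rw [skipPoly_eval_eq_zero c i (by omega) (by omega), mul_zero]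
    · simp
  · have h1 := congrFun (Polynomial.fwdDiff_iter_eq_zero_of_degree_lt
      ((natDegree_skipPoly_le c).trans_lt (not_le.1 h))) 0
    rw [fwdDiff_iter_eq_sum_shift] at h1
    have h2 : ∑ i ∈ Finset.range (k + 1), (-1 : ℚ) ^ i * k.choose i * (skipPoly c).eval (i : ℚ) =
        (-1) ^ k * ∑ i ∈ Finset.range (k + 1),
          ((-1 : ℤ) ^ (k - i) * k.choose i) • (skipPoly c).eval (0 + i • (1 : ℚ)) := by
      rw [Finset.mul_sum]
      refine Finset.sum_congr rfl fun i hi => ?_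
      rw [Finset.mem_range] at hi
      have h3 : (-1 : ℚ) ^ k * (-1) ^ (k - i) = (-1) ^ i := by
        rw [← pow_add, show k + (k - i) = 2 * (k - i) + i by omega, pow_add, pow_mul]
        simp
      rw [← h3, zsmul_eq_mul]
      push_cast
      simp only [zero_add, nsmul_eq_mul, mul_one]
      ring
    rw [h2, h1]
    simp

theorem sum_fin_ite_le (B c : ℕ) (u v : ℚ) :
    ∑ a : Fin B, (if (a : ℕ) ≤ c then u else v) =
      (min B (c + 1) : ℕ) * u + ((B : ℚ) - (min B (c + 1) : ℕ)) * v := by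
  induction B with
  | zero => simp
  | succ B ih =>
    rw [Fin.sum_univ_castSucc]
    simp only [Fin.val_castSucc, Fin.val_last, ih]
    split_ifs with h
    · rw [min_eq_left (by omega), min_eq_left (by omega)]
      push_cast; ring
    · rw [min_eq_right (by omega), min_eq_right (by omega)]
      push_cast; ring

/-- Summing over the last exponent, when c < B, gives (c + 1) p_{c+1} + (B - c - 1) p_c = (B - i)
p_c at the point i, with p_c the polynomial `skipPoly c`; so one factor splits off per variable. The
hypothesis on B covers small bounds: an earlier factor B q - i is then zero. -/
theorem sum_skipPoly_skipCount (i : ℕ) : ∀ (N : ℕ) (B : Fin N → ℕ)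
    (_ : ∀ p, B p < i → ∃ q, q < p ∧ B q = i) (c : ℕ),
    ∑ m : (p : Fin N) → Fin (B p), (skipPoly (skipCount N (fun p => m p) c)).eval (i : ℚ) =
      (∏ p, ((B p : ℚ) - i)) * (skipPoly c).eval (i : ℚ) := by
  intro N
  induction N with
  | zero => intro B _ c; simp [skipCount]
  | succ N ih =>
    intro B hB c
    have hB' : ∀ p : Fin N, B p.castSucc < i → ∃ q, q < p ∧ B q.castSucc = i := by
      intro p hp
      obtain ⟨q, hq, h⟩ := hB _ hp
      refine ⟨q.castPred (Fin.ne_last_of_lt hq), ?_, by simpa using h⟩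
      rw [← Fin.castSucc_lt_castSucc_iff]
      simpa using hq
    rw [← (Fin.snocEquiv fun p => Fin (B p)).sum_comp, Fintype.sum_prod_type]
    simp only [Fin.snocEquiv_apply, skipCount, Fin.snoc_last, Fin.snoc_castSucc]
    have h1 : ∀ a : Fin (B (Fin.last N)), (∑ m : (p : Fin N) → Fin (B p.castSucc),
        (skipPoly (if (a : ℕ) ≤ c then skipCount N (fun p => (m p : ℕ)) (c + 1)
          else skipCount N (fun p => (m p : ℕ)) c)).eval (i : ℚ)) =
        if (a : ℕ) ≤ c then (∏ p : Fin N, ((B p.castSucc : ℚ) - i)) * (skipPoly (c + 1)).eval (i : ℚ)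
        else (∏ p : Fin N, ((B p.castSucc : ℚ) - i)) * (skipPoly c).eval (i : ℚ) := by
      intro a
      split_ifs with h
      · exact ih (fun p => B p.castSucc) hB' (c + 1)
      · exact ih (fun p => B p.castSucc) hB' c
    refine (Finset.sum_congr rfl fun a _ => h1 a).trans ?_
    rw [sum_fin_ite_le, Fin.prod_univ_castSucc]
    rcases Nat.lt_or_ge c (B (Fin.last N)) with hc | hc
    · rw [min_eq_right (by omega)]
      have h := skipPoly_succ_eval c i
      push_cast
      linear_combination (∏ p : Fin N, ((B p.castSucc : ℚ) - i)) * h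
    · rw [min_eq_left (by omega), sub_self, zero_mul, add_zero]
      rcases Nat.eq_zero_or_pos i with rfl | hi
      · simp [skipPoly_eval_zero]; ring
      -- Here B ≤ c. If B < i, an earlier factor vanishes on both sides; if i ≤ B, then 1 ≤ i ≤ c
      -- and the polynomials themselves vanish at i.
      rcases Nat.lt_or_ge (B (Fin.last N)) i with hi2 | hi2
      · obtain ⟨q, hq, h⟩ := hB _ hi2
        have h0 : ∏ p : Fin N, ((B p.castSucc : ℚ) - i) = 0 := by
          refine Finset.prod_eq_zero (Finset.mem_univ (q.castPred (Fin.ne_last_of_lt hq))) ?_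
          simp [h]
        simp [h0]
      · rw [skipPoly_eval_eq_zero c i hi (by omega),
          skipPoly_eval_eq_zero (c + 1) i hi (by omega)]
        simp

section Counting

variable {r : ℕ}

/-- The bound for the exponents of the variable `x_p` in a standard monomial. -/
def batchBound (α : Fin r → ℕ) (k : ℕ) (p : Fin (compSize α)) : ℕ :=
  k - ((finSigmaFinEquiv.symm p).2 : ℕ)

@[simp] theorem batchBound_batchIndex (α : Fin r → ℕ) (k : ℕ) (i : Fin r) (j : Fin (α i)) :
    batchBound α k (batchIndex α i j) = k - (j : ℕ) := by
  have h : finSigmaFinEquiv.symm (batchIndex α i j) = ⟨i, j⟩ := by simp [batchIndex]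
  simp only [batchBound]
  rw [h]

theorem forall_batchIndex {α : Fin r → ℕ} {Q : Fin (compSize α) → Prop} :
    (∀ p, Q p) ↔ ∀ i j, Q (batchIndex α i j) := by
  refine ⟨fun h i j => h _, fun h p => ?_⟩
  obtain ⟨j, hj⟩ := exists_batchIndex α _ p rfl
  exact hj ▸ h _ j

theorem prod_batchIndex {M : Type*} [CommMonoid M] (α : Fin r → ℕ) (g : Fin (compSize α) → M) :
    ∏ p, g p = ∏ i, ∏ j, g (batchIndex α i j) := by
  rw [← Fintype.prod_sigma', ← (finSigmaFinEquiv (n := α)).prod_comp]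
  rfl

/-- The standard exponent vectors as elements of a product of finite types. -/
noncomputable def standardExpsEquiv (α : Fin r → ℕ) (k : ℕ) :
    standardExps α k ≃ {m : (p : Fin (compSize α)) → Fin (batchBound α k p) //
      k ≤ skipCount (compSize α) (fun p => m p) 0} where
  toFun m := ⟨fun p => ⟨m.1 p, (forall_batchIndex (Q := fun p => m.1 p < batchBound α k p)).2
    (fun i j => by rw [batchBound_batchIndex]; exact m.2.2 i j) p⟩, m.2.1⟩
  invFun m := ⟨Finsupp.equivFunOnFinite.symm fun p => (m.1 p : ℕ), m.2, fun i j => by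
    exact (m.1 (batchIndex α i j)).2.trans_eq (batchBound_batchIndex α k i j)⟩
  left_inv m := by ext; rfl
  right_inv m := rfl

instance (α : Fin r → ℕ) (k : ℕ) : Finite (standardExps α k) :=
  Finite.of_equiv _ (standardExpsEquiv α k).symm

theorem card_standardExps (α : Fin r → ℕ) (k : ℕ) (hα : ∀ i, α i ≤ k) :
    (Nat.card (standardExps α k) : ℚ) =
      ∑ i ∈ Finset.range (k + 1), (-1 : ℚ) ^ i * k.choose i *
        ∏ l, ((k - i).descFactorial (α l) : ℚ) := by
  classical
  rw [Nat.card_congr (standardExpsEquiv α k), Nat.card_eq_fintype_card, Fintype.card_subtype,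
    Finset.card_filter]
  push_cast
  simp only [← sum_choose_skipPoly k]
  rw [Finset.sum_comm]
  refine Finset.sum_congr rfl fun i hi => ?_
  rw [Finset.mem_range] at hi
  rw [← Finset.mul_sum, sum_skipPoly_skipCount, skipPoly_zero, Polynomial.eval_one, mul_one,
    prod_batchIndex]
  · congr 1
    refine Finset.prod_congr rfl fun l _ => ?_
    rw [← descPochhammer_eval_eq_descFactorial, descPochhammer_eval_eq_prod_range,
      ← Fin.prod_univ_eq_prod_range (fun j => (((k - i : ℕ) : ℚ) - (j : ℚ)))]
    refine Finset.prod_congr rfl fun j _ => ?_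
    have hj := j.2
    have hl := hα l
    rw [batchBound_batchIndex, Nat.cast_sub (by omega), Nat.cast_sub (by omega)]
    ring
  · rw [forall_batchIndex]
    intro l j hj
    rw [batchBound_batchIndex] at hj
    have hj2 := j.2
    -- The bounds in a batch are k, k - 1, …, so a bound below i is preceded by the bound i, at
    -- zero-based offset k - i.
    refine ⟨batchIndex α l ⟨k - i, by omega⟩, ?_, ?_⟩
    · rw [batchIndex_lt_iff, Fin.lt_def]
      simp only
      omega
    · rw [batchBound_batchIndex]
      simp only
      omega

/-- The maps from positions to blocks that are injective on every batch. -/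
abbrev BatchInjective (α : Fin r → ℕ) (k : ℕ) : Type :=
  {φ : Fin (compSize α) → Fin k // ∀ i, Function.Injective fun j => φ (batchIndex α i j)}

/-- The surjective maps from positions to blocks that are injective on every batch. -/
abbrev BlockMap (α : Fin r → ℕ) (k : ℕ) : Type :=
  {φ : Fin (compSize α) → Fin k //
    Function.Surjective φ ∧ ∀ i, Function.Injective fun j => φ (batchIndex α i j)}

/-- Batchwise injective maps with values outside `t` as families of embeddings. -/
def batchInjectiveEquiv (α : Fin r → ℕ) (k : ℕ) (t : Finset (Fin k)) :
    {φ : BatchInjective α k // ∀ b ∈ t, ∀ p, φ.1 p ≠ b} ≃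
      ((i : Fin r) → (Fin (α i) ↪ {b : Fin k // b ∉ t})) where
  toFun φ i := ⟨fun j => ⟨φ.1.1 (batchIndex α i j), fun h => φ.2 _ h _ rfl⟩,
    fun _ _ h => φ.1.2 i (congrArg Subtype.val h)⟩
  invFun e := ⟨⟨fun p => (e _ (finSigmaFinEquiv.symm p).2).1, fun i => by
      have h : ∀ j, finSigmaFinEquiv.symm (batchIndex α i j) = ⟨i, j⟩ := by
        intro j; simp [batchIndex]
      intro a b hab
      simp only at hab
      rw [h, h] at hab
      exact (e i).injective (Subtype.ext hab)⟩, fun b hb p h => (e _ _).2 (h ▸ hb)⟩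
  left_inv φ := by
    ext p
    simp [batchIndex]
  right_inv e := by
    funext i
    ext j
    have h : finSigmaFinEquiv.symm (batchIndex α i j) = ⟨i, j⟩ := by simp [batchIndex]
    have h' : ∀ s : (i : Fin r) × Fin (α i), s = ⟨i, j⟩ → (e s.1 s.2).1 = (e i j).1 := by
      rintro _ rfl; rfl
    exact congrArg Fin.val (h' _ h)

/-- Inclusion–exclusion over the set of missed blocks: with i blocks forbidden, each batch is
embedded independently into the k - i remaining ones. -/
theorem card_blockMap (α : Fin r → ℕ) (k : ℕ) :
    (Nat.card (BlockMap α k) : ℚ) =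
      ∑ i ∈ Finset.range (k + 1), (-1 : ℚ) ^ i * k.choose i *
        ∏ l, ((k - i).descFactorial (α l) : ℚ) := by
  classical
  let T : Fin k → Finset (BatchInjective α k) := fun b =>
    Finset.univ.filter fun φ => ∀ p, φ.1 p ≠ b
  have h1 : Nat.card (BlockMap α k) = (Finset.univ.inf fun b => (T b)ᶜ).card := by
    rw [Nat.card_eq_fintype_card, ← Fintype.card_coe]
    refine Fintype.card_congr ⟨fun φ => ⟨⟨φ.1, φ.2.2⟩, ?_⟩, fun φ => ⟨φ.1.1, ?_, φ.1.2⟩,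
      fun _ => rfl, fun _ => rfl⟩
    · rw [Finset.mem_inf]
      intro b _
      obtain ⟨p, hp⟩ := φ.2.1 b
      simp only [T, Finset.mem_compl, Finset.mem_filter, Finset.mem_univ, true_and, not_forall,
        not_not]
      exact ⟨p, hp⟩
    · intro b
      have h := (Finset.mem_inf.1 φ.2) b (Finset.mem_univ b)
      simp only [T, Finset.mem_compl, Finset.mem_filter, Finset.mem_univ, true_and, not_forall,
        not_not] at h
      exact h
  have h2 : ∀ t : Finset (Fin k), (t.inf T).card = ∏ l, (k - t.card).descFactorial (α l) := by
    intro t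
    have h3 : t.inf T = Finset.univ.filter fun φ : BatchInjective α k =>
        ∀ b ∈ t, ∀ p, φ.1 p ≠ b := by
      ext φ
      simp [Finset.mem_inf, T]
    rw [h3, ← Fintype.card_subtype, Fintype.card_congr (batchInjectiveEquiv α k t),
      Fintype.card_pi]
    refine Finset.prod_congr rfl fun l _ => ?_
    rw [Fintype.card_embedding_eq, Fintype.card_fin, Fintype.card_subtype_compl,
      Fintype.card_fin, Fintype.card_coe]
  have h4 := Finset.inclusion_exclusion_card_inf_compl Finset.univ T
  rw [h1, ← Int.cast_natCast, h4]
  push_cast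
  simp only [h2]
  rw [Finset.sum_powerset_apply_card
    (fun c => (-1 : ℚ) ^ c * ((∏ l, (k - c).descFactorial (α l) : ℕ) : ℚ))]
  rw [Finset.card_univ, Fintype.card_fin]
  refine Finset.sum_congr rfl fun i _ => ?_
  rw [nsmul_eq_mul]
  push_cast
  ring

theorem card_standardExps_eq_card_blockMap (α : Fin r → ℕ) (k : ℕ) (hα : ∀ i, α i ≤ k) :
    Nat.card (standardExps α k) = Nat.card (BlockMap α k) := by
  have h := (card_standardExps α k hα).trans (card_blockMap α k).symm
  exact_mod_cast h

theorem ncard_orderedPartitions (α : Fin r → ℕ) (k : ℕ) :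
    (orderedPartitions α k).ncard = Nat.card (BlockMap α k) := by
  let F : BlockMap α k → (Fin k → Finset (Fin (compSize α))) := fun φ b =>
    Finset.univ.filter fun p => φ.1 p = b
  have hF : Function.Injective F := by
    intro φ ψ h
    ext p : 2
    have h1 : p ∈ F ψ (φ.1 p) := by rw [← h]; simp [F]
    simp only [F, Finset.mem_filter, Finset.mem_univ, true_and] at h1
    exact h1.symm
  have hR : Set.range F = orderedPartitions α k := by
    ext σ
    constructor
    · rintro ⟨φ, rfl⟩
      refine ⟨⟨fun b => ?_, fun b c hbc => ?_, fun p => ⟨φ.1 p, by simp [F]⟩⟩, ?_⟩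
      · obtain ⟨p, hp⟩ := φ.2.1 b
        exact ⟨p, by simp [F, hp]⟩
      · rw [Finset.disjoint_left]
        intro p h1 h2
        simp only [F, Finset.mem_filter, Finset.mem_univ, true_and] at h1 h2
        exact hbc (h1.symm.trans h2)
      · rintro i j j' hne b ⟨h1, h2⟩
        simp only [F, Finset.mem_filter, Finset.mem_univ, true_and] at h1 h2
        exact hne (φ.2.2 i (h1.trans h2.symm))
    · rintro ⟨⟨h1, h2, h3⟩, h4⟩
      choose φ hφ using h3
      have hu : ∀ p b, p ∈ σ b → φ p = b := by
        intro p b hb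
        by_contra hne
        exact Finset.disjoint_left.1 (h2 _ _ hne) (hφ p) hb
      refine ⟨⟨φ, fun b => ?_, fun i j j' h => ?_⟩, ?_⟩
      · obtain ⟨p, hp⟩ := h1 b
        exact ⟨p, hu p b hp⟩
      · by_contra hne
        refine h4 i j j' hne _ ⟨hφ _, ?_⟩
        simp only at h
        rw [h]
        exact hφ _
      · funext b
        ext p
        simp only [F, Finset.mem_filter, Finset.mem_univ, true_and]
        exact ⟨fun h => h ▸ hφ p, hu p b⟩
  rw [← hR, ← Nat.card_coe_set_eq]
  exact Nat.card_range_of_injective hF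

end Counting

/-! ### Skip monomials and the greedy count -/

/-- The number of entries after `p` that are not marked. -/
def unmarkedAfter {N : ℕ} (T : Fin N → Bool) (p : Fin N) : ℕ :=
  ∑ q, if p < q ∧ T q = false then 1 else 0

/-- The number of entries that are not marked. -/
def unmarked {N : ℕ} (T : Fin N → Bool) : ℕ := ∑ q, if T q = false then 1 else 0

theorem unmarked_snoc {N : ℕ} (T : Fin N → Bool) (b : Bool) :
    unmarked (Fin.snoc (α := fun _ => Bool) T b) = unmarked T + if b = false then 1 else 0 := by
  simp only [unmarked, Fin.sum_univ_castSucc, Fin.snoc_castSucc, Fin.snoc_last]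

theorem unmarkedAfter_snoc_last {N : ℕ} (T : Fin N → Bool) (b : Bool) :
    unmarkedAfter (Fin.snoc (α := fun _ => Bool) T b) (Fin.last N) = 0 :=
  Finset.sum_eq_zero fun q _ => if_neg fun h => (Fin.le_last q).not_gt h.1

theorem unmarkedAfter_snoc_castSucc {N : ℕ} (T : Fin N → Bool) (b : Bool) (p : Fin N) :
    unmarkedAfter (Fin.snoc (α := fun _ => Bool) T b) p.castSucc =
      unmarkedAfter T p + if b = false then 1 else 0 := by
  simp only [unmarkedAfter, Fin.sum_univ_castSucc, Fin.snoc_castSucc, Fin.snoc_last,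
    Fin.castSucc_lt_last, Fin.castSucc_lt_castSucc_iff, true_and]

/-- Greedy choice: mark the entries that exceed the state. To reach a larger s, stop marking once
all the remaining entries are needed as unmarked ones. -/
theorem exists_marking (N : ℕ) : ∀ (e : Fin N → ℕ) (c s : ℕ), skipCount N e c ≤ s → s ≤ c + N →
    ∃ T : Fin N → Bool, c + unmarked T = s ∧
      ∀ p, T p = true → c + unmarkedAfter T p + 1 ≤ e p := by
  induction N with
  | zero =>
    intro e c s h1 h2
    rw [skipCount] at h1
    exact ⟨fun _ => true, by simp [unmarked]; omega, fun p => p.elim0⟩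
  | succ N ih =>
    intro e c s h1 h2
    rw [skipCount] at h1
    split_ifs at h1 with h
    · obtain ⟨T, h3, h4⟩ := ih _ _ s h1 (by omega)
      refine ⟨Fin.snoc (α := fun _ => Bool) T false, ?_, fun p => ?_⟩
      · rw [unmarked_snoc, if_pos rfl]; omega
      · refine Fin.lastCases ?_ (fun p => ?_) p
        · simp
        · intro hp
          have := h4 p (by simpa using hp)
          rw [unmarkedAfter_snoc_castSucc, if_pos rfl]
          omega
    · rcases h2.lt_or_eq with h2 | h2
      · obtain ⟨T, h3, h4⟩ := ih _ _ s h1 (by omega)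
        refine ⟨Fin.snoc (α := fun _ => Bool) T true, ?_, fun p => ?_⟩
        · rw [unmarked_snoc, if_neg (by simp)]; omega
        · refine Fin.lastCases ?_ (fun p => ?_) p
          · intro _
            rw [unmarkedAfter_snoc_last]
            omega
          · intro hp
            have := h4 p (by simpa using hp)
            rw [unmarkedAfter_snoc_castSucc, if_neg (by simp)]
            omega
      · exact ⟨fun _ => false, by simp [unmarked]; omega, fun p hp => by simp at hp⟩

/-- The greedy count is minimal. A marked entry exceeds c' ≥ c, so neither state moves; at an
unmarked entry c' gains one and c at most one, which preserves c ≤ c'. -/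
theorem skipCount_le_of_marking (N : ℕ) : ∀ (e : Fin N → ℕ) (c c' : ℕ) (T : Fin N → Bool), c ≤ c' →
    (∀ p, T p = true → c' + unmarkedAfter T p + 1 ≤ e p) →
    skipCount N e c ≤ c' + unmarked T := by
  induction N with
  | zero => intro e c c' T h _; rw [skipCount]; omega
  | succ N ih =>
    intro e c c' T
    refine Fin.snocCases (fun T b => ?_) T
    intro h hT
    have h1 := hT (Fin.last N)
    have h2 : ∀ p, T p = true → c' + (unmarkedAfter T p + if b = false then 1 else 0) + 1
        ≤ e p.castSucc := by
      intro p hp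
      rw [← unmarkedAfter_snoc_castSucc]
      exact hT p.castSucc (by simpa using hp)
    rw [Fin.snoc_last, unmarkedAfter_snoc_last] at h1
    rw [unmarked_snoc, skipCount]
    cases b with
    | true =>
      have h3 := h1 rfl
      rw [if_neg (by omega), if_neg (by simp)]
      exact ih _ c c' T h fun p hp => by simpa using h2 p hp
    | false =>
      simp only [if_true] at h2 ⊢
      rw [add_comm (unmarked T), ← add_assoc]
      split_ifs
      · exact ih _ (c + 1) (c' + 1) T (by omega) fun p hp => by have := h2 p hp; omega
      · exact ih _ c (c' + 1) T (by omega) fun p hp => by have := h2 p hp; omega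

theorem skipSeq_of_mem {n : ℕ} (S : Finset (Fin n)) (i : Fin n) (hi : i ∈ S) :
    skipSeq S i = unmarkedAfter (fun p => decide (p.rev ∈ S)) i.rev + 1 := by
  have h1 : unmarkedAfter (fun p => decide (p.rev ∈ S)) i.rev =
      ((Finset.Iic i).filter (· ∉ S)).card := by
    rw [unmarkedAfter, ← Equiv.sum_comp Fin.revPerm, ← Finset.card_filter]
    congr 1
    ext q
    simp only [Fin.revPerm_apply, Fin.rev_lt_rev, Fin.rev_rev, decide_eq_false_iff_not,
      Finset.mem_filter, Finset.mem_univ, true_and, Finset.mem_Iic]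
    refine and_congr_left fun hq => ⟨le_of_lt, fun h => h.lt_of_ne ?_⟩
    rintro rfl
    exact hq hi
  have h2 : (S.filter (· ≤ i)) = (Finset.Iic i).filter (· ∈ S) := by
    ext q; simp [and_comm]
  have h3 := Finset.card_filter_add_card_filter_not (s := Finset.Iic i) (· ∈ S)
  rw [Fin.card_Iic] at h3
  rw [skipSeq, if_pos hi, h1, h2]
  omega

theorem card_add_unmarked {n : ℕ} (S : Finset (Fin n)) :
    S.card + unmarked (fun p => decide (p.rev ∈ S)) = n := by
  have h1 : unmarked (fun p => decide (p.rev ∈ S)) = (Finset.univ.filter (· ∉ S)).card := by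
    rw [unmarked, ← Equiv.sum_comp Fin.revPerm, ← Finset.card_filter]
    simp
  have h3 := Finset.card_filter_add_card_filter_not (s := (Finset.univ : Finset (Fin n))) (· ∈ S)
  rw [Finset.filter_mem_eq_inter, Finset.univ_inter, Finset.card_univ, Fintype.card_fin] at h3
  rw [h1, h3]

theorem exists_revSkipSeq_le_iff {n k : ℕ} (hk : 0 < k) (m : Fin n → ℕ) :
    (∃ S : Finset (Fin n), S.card = n + 1 - k ∧ ∀ p, revSkipSeq S p ≤ m p) ↔
      skipCount n m 0 < k := by
  constructor
  · rintro ⟨S, h1, h2⟩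
    have h := skipCount_le_of_marking n m 0 0 (fun p => decide (p.rev ∈ S)) le_rfl (by
      intro p hp
      have h3 := h2 p
      rw [revSkipSeq, skipSeq_of_mem S _ (by simpa using hp), Fin.rev_rev] at h3
      omega)
    have h4 := card_add_unmarked S
    omega
  · intro h
    have hle : skipCount n m 0 ≤ n := by
      have h5 := skipCount_le_of_marking n m 0 0 (fun _ => false) le_rfl (by simp)
      simpa [unmarked] using h5
    -- Leaving min(n, k - 1) entries unmarked makes the number of marked ones n + 1 - k with
    -- truncated subtraction, which covers k > n.
    obtain ⟨T, h1, h2⟩ := exists_marking n m 0 (min n (k - 1)) (by omega) (by omega)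
    let S : Finset (Fin n) := Finset.univ.filter fun i => T i.rev = true
    have hS : (fun p => decide (Fin.rev p ∈ S)) = T := by
      funext p
      simp [S]
    refine ⟨S, ?_, fun p => ?_⟩
    · have h3 := card_add_unmarked S
      rw [hS] at h3
      omega
    · rw [revSkipSeq]
      by_cases hp : p.rev ∈ S
      · rw [skipSeq_of_mem S _ hp, hS, Fin.rev_rev]
        have h4 := h2 p (by simpa [S] using hp)
        omega
      · rw [skipSeq, if_neg hp]
        exact Nat.zero_le _

theorem nonskip_eq_standardExps {r : ℕ} (α : Fin r → ℕ) {k : ℕ} (hk : 0 < k) :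
    nonskip α k = standardExps α k := by
  ext m
  have h := exists_revSkipSeq_le_iff hk (m : Fin (compSize α) → ℕ)
  rw [nonskip, standardExps, Set.mem_ofPred_eq, Set.mem_ofPred_eq, ← not_lt, ← h]
  simp only [not_exists, not_and, not_le]

theorem coeff_prod_one_sub_eq_zero {ι S : Type*} [CommRing S] (z : ι → S) (t : Finset ι) :
    ∀ d, t.card < d →
      PowerSeries.coeff d (∏ b ∈ t, (1 - PowerSeries.C (z b) * PowerSeries.X)) = 0 := by
  classical
  induction t using Finset.induction_on with
  | empty =>
    intro d hd
    rw [Finset.prod_empty, PowerSeries.coeff_one, if_neg (by simp at hd; omega)]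
  | insert a t ha ih =>
    intro d hd
    rw [Finset.card_insert_of_notMem ha] at hd
    obtain ⟨d, rfl⟩ : ∃ e, d = e + 1 := ⟨d - 1, by omega⟩
    rw [Finset.prod_insert ha, sub_mul, one_mul, map_sub, ih _ (by omega), mul_assoc,
      PowerSeries.coeff_C_mul, mul_comm PowerSeries.X, PowerSeries.coeff_succ_mul_X,
      ih _ (by omega)]
    simp

/-! ### Evaluation at the points of the deformation -/

section Points

variable {r k : ℕ} {S : Type*} [CommRing S]

/-- Surjectivity of φ makes ∏(T - z_b) divide ∏(T - z_{φ(p)}), so the remainder is zero. Injectivity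
on a batch lets its factors cancel from ∏(1 - z_b u), leaving a polynomial of degree at most k -
α_i. -/
theorem eval_eq_zero_of_mem_deformedIdeal (α : Fin r → ℕ) (z : Fin k → S) (φ : BlockMap α k)
    (f : MvPolynomial (Fin (compSize α)) S) (hf : f ∈ deformedIdeal α z) :
    eval (fun p => z (φ.1 p)) f = 0 := by
  classical
  rw [← RingHom.mem_ker]
  refine (?_ : deformedIdeal α z ≤ _) hf
  have hC : (eval fun p => z (φ.1 p)).comp C = RingHom.id S := by ext; simp
  rw [deformedIdeal, Ideal.span_le]
  rintro _ (⟨d, _, rfl⟩ | ⟨i, d, h1, h2, rfl⟩) <;> rw [SetLike.mem_coe, RingHom.mem_ker]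
  · rw [← Polynomial.coeff_map, Polynomial.map_modByMonic _ ((blockPoly_monic z).map _),
      Polynomial.map_map, hC, Polynomial.map_id,
      (Polynomial.modByMonic_eq_zero_iff_dvd (blockPoly_monic z)).2, Polynomial.coeff_zero]
    -- One position chosen in each block exhibits ∏(T - z_b) as a subproduct.
    obtain ⟨s, hs⟩ := φ.2.1.hasRightInverse
    have h : blockPoly z = ∏ p ∈ Finset.univ.image s,
        (Polynomial.X - Polynomial.C (z (φ.1 p))) := by
      rw [Finset.prod_image hs.injective.injOn, blockPoly]
      exact Finset.prod_congr rfl fun b _ => by rw [hs b]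
    rw [h, genericProd, Polynomial.map_prod]
    simp only [Polynomial.map_sub, Polynomial.map_X, Polynomial.map_C, eval_X]
    exact Finset.prod_dvd_prod_of_subset _ _ _ (Finset.subset_univ _)
  · have hB : ((blockSeries z).map C).map (eval fun p => z (φ.1 p)) = blockSeries z := by
      ext e
      simp
    rw [← PowerSeries.coeff_map, map_mul, hB, batchSeries_all, map_prod]
    simp only [map_geomSeries, eval_X]
    let t : Finset (Fin k) := Finset.univ.image fun j => φ.1 (batchIndex α i j)
    have h3 : blockSeries z =
        (∏ b ∈ Finset.univ \ t, (1 - PowerSeries.C (z b) * PowerSeries.X)) *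
          ∏ j, (1 - PowerSeries.C (z (φ.1 (batchIndex α i j))) * PowerSeries.X) := by
      rw [blockSeries, ← Finset.prod_sdiff (Finset.subset_univ t)]
      congr 1
      exact Finset.prod_image (φ.2.2 i).injOn
    have h4 : (∏ j, (1 - PowerSeries.C (z (φ.1 (batchIndex α i j))) * PowerSeries.X)) *
        ∏ j, geomSeries (z (φ.1 (batchIndex α i j))) = 1 := by
      rw [← Finset.prod_mul_distrib]
      exact Finset.prod_eq_one fun j _ => by rw [mul_comm, geomSeries_mul_one_sub]
    have h5 : α i ≤ k := by simpa using Fintype.card_le_of_injective _ (φ.2.2 i)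
    rw [h3, mul_assoc, h4, mul_one]
    refine coeff_prod_one_sub_eq_zero z _ d ?_
    rw [Finset.card_sdiff_of_subset (Finset.subset_univ t), Finset.card_univ, Fintype.card_fin,
      Finset.card_image_of_injective _ (φ.2.2 i), Finset.card_univ, Fintype.card_fin]
    omega

theorem exists_sub_sum_mem_deformedIdeal [Nontrivial S] (α : Fin r → ℕ) (z : Fin k → S)
    [Fintype (standardExps α k)] (f : MvPolynomial (Fin (compSize α)) S) :
    ∃ c : standardExps α k → S,
      f - ∑ m, c m • monomial m.1 (1 : S) ∈ deformedIdeal α z := by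
  obtain ⟨a, ha, b, hb, rfl⟩ := Submodule.mem_sup.1 (mem_span_standard_sup α z f)
  rw [Set.image_eq_range, Submodule.mem_span_range_iff_exists_fun] at ha
  obtain ⟨c, rfl⟩ := ha
  exact ⟨c, by simpa using hb⟩

variable {K : Type*} [Field K] [Algebra S K]

/-- The function on the set of points `z ∘ φ` defined by a polynomial. -/
noncomputable def pointValues (K : Type*) [Field K] [Algebra S K] (α : Fin r → ℕ) (z : Fin k → S) :
    MvPolynomial (Fin (compSize α)) S →ₗ[S] (BlockMap α k → K) :=
  LinearMap.pi fun φ => (Algebra.linearMap S K).comp (aeval fun p => z (φ.1 p)).toLinearMap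

theorem pointValues_apply (α : Fin r → ℕ) (z : Fin k → S) (f : MvPolynomial (Fin (compSize α)) S)
    (φ : BlockMap α k) :
    pointValues K α z f φ = algebraMap S K (eval (fun p => z (φ.1 p)) f) := rfl

theorem pointValues_eq_zero (α : Fin r → ℕ) (z : Fin k → S)
    (f : MvPolynomial (Fin (compSize α)) S) (hf : f ∈ deformedIdeal α z) :
    pointValues K α z f = 0 := by
  funext φ
  rw [pointValues_apply, eval_eq_zero_of_mem_deformedIdeal α z φ f hf, map_zero, Pi.zero_apply]

theorem pointValues_mem_span [Nontrivial S] (α : Fin r → ℕ) (z : Fin k → S)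
    (f : MvPolynomial (Fin (compSize α)) S) :
    pointValues K α z f ∈ Submodule.span K (Set.range fun m : standardExps α k =>
      pointValues K α z (monomial m.1 1)) := by
  have := Fintype.ofFinite (standardExps α k)
  obtain ⟨c, hc⟩ := exists_sub_sum_mem_deformedIdeal α z f
  have h := pointValues_eq_zero (K := K) α z _ hc
  rw [map_sub, sub_eq_zero] at h
  rw [h, map_sum]
  refine Submodule.sum_mem _ fun m _ => ?_
  rw [map_smul, ← algebraMap_smul K (c m)]
  exact Submodule.smul_mem _ _ (Submodule.subset_span ⟨m, rfl⟩)

theorem span_pointValues [Nontrivial S] (α : Fin r → ℕ) (z : Fin k → S)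
    (hz : Function.Injective fun b => algebraMap S K (z b)) :
    ⊤ ≤ Submodule.span K (Set.range fun m : standardExps α k =>
      pointValues K α z (monomial m.1 1)) := by
  classical
  rw [← (Pi.basisFun K (BlockMap α k)).span_eq, Submodule.span_le]
  rintro _ ⟨φ, rfl⟩
  rw [Pi.basisFun_apply, SetLike.mem_coe]
  -- A Lagrange interpolation numerator: nonzero at the point of φ and zero at every other one.
  let q : MvPolynomial (Fin (compSize α)) S :=
    ∏ p, ∏ b ∈ Finset.univ.erase (φ.1 p), (X p - C (z b))
  have hq : ∀ ψ : BlockMap α k, pointValues K α z q ψ =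
      ∏ p, ∏ b ∈ Finset.univ.erase (φ.1 p),
        (algebraMap S K (z (ψ.1 p)) - algebraMap S K (z b)) := by
    intro ψ
    rw [pointValues_apply]
    simp [q, map_prod]
  have h0 : pointValues K α z q φ ≠ 0 := by
    rw [hq]
    refine Finset.prod_ne_zero_iff.2 fun p _ => Finset.prod_ne_zero_iff.2 fun b hb => ?_
    rw [sub_ne_zero]
    exact fun h => (Finset.ne_of_mem_erase hb) (hz h).symm
  have h1 : Pi.single φ (1 : K) = (pointValues K α z q φ)⁻¹ • pointValues K α z q := by
    funext ψ
    by_cases h : ψ = φ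
    · subst h
      simp [h0]
    · rw [Pi.single_eq_of_ne h, Pi.smul_apply, hq ψ]
      obtain ⟨p, hp⟩ : ∃ p, ψ.1 p ≠ φ.1 p := by
        by_contra h2
        push Not at h2
        exact h (Subtype.ext (funext h2))
      rw [Finset.prod_eq_zero (Finset.mem_univ p), smul_zero]
      exact Finset.prod_eq_zero (Finset.mem_erase.2 ⟨hp, Finset.mem_univ _⟩) (sub_self _)
  rw [h1]
  exact Submodule.smul_mem _ _ (pointValues_mem_span α z q)

/-- The functions defined by the standard monomials form a basis. -/
noncomputable def pointBasis [Nontrivial S] (α : Fin r → ℕ) (hα : ∀ i, α i ≤ k) (z : Fin k → S)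
    (hz : Function.Injective fun b => algebraMap S K (z b)) :
    Module.Basis (standardExps α k) K (BlockMap α k → K) :=
  have := Fintype.ofFinite (standardExps α k)
  Module.Basis.mk (linearIndependent_of_top_le_span_of_card_eq_finrank (span_pointValues α z hz) (by
    rw [Module.finrank_fintype_fun_eq_card, ← Nat.card_eq_fintype_card, ← Nat.card_eq_fintype_card,
      card_standardExps_eq_card_blockMap α k hα])) (span_pointValues α z hz)

theorem pointBasis_apply [Nontrivial S] (α : Fin r → ℕ) (hα : ∀ i, α i ≤ k) (z : Fin k → S)
    (hz : Function.Injective fun b => algebraMap S K (z b)) (m : standardExps α k) :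
    pointBasis α hα z hz m = pointValues K α z (monomial m.1 1) := by
  simp [pointBasis]

theorem eq_zero_of_sum_mem_deformedIdeal [Nontrivial S] [FaithfulSMul S K] (α : Fin r → ℕ)
    (hα : ∀ i, α i ≤ k) (z : Fin k → S)
    (hz : Function.Injective fun b => algebraMap S K (z b)) [Fintype (standardExps α k)]
    (c : standardExps α k → S) (hc : ∑ m, c m • monomial m.1 (1 : S) ∈ deformedIdeal α z) :
    ∀ m, c m = 0 := by
  have h := pointValues_eq_zero (K := K) α z _ hc
  rw [map_sum] at h
  have h1 : ∑ m, algebraMap S K (c m) • pointBasis α hα z hz m = 0 := by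
    rw [← h]
    refine Finset.sum_congr rfl fun m _ => ?_
    rw [map_smul, pointBasis_apply, algebraMap_smul]
  intro m
  have h2 := (Fintype.linearIndependent_iff.1 (pointBasis α hα z hz).linearIndependent) _ h1 m
  exact (map_eq_zero_iff _ (FaithfulSMul.algebraMap_injective S K)).1 h2

theorem trace_eq_sum_of_basis {R M ι : Type*} [CommRing R] [AddCommGroup M] [Module R M]
    [Fintype ι] (b : Module.Basis ι R M) (f : M →ₗ[R] M) (A : ι → ι → R)
    (h : ∀ j, f (b j) = ∑ i, A i j • b i) : LinearMap.trace R M f = ∑ i, A i i := by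
  classical
  rw [LinearMap.trace_eq_matrix_trace R b, Matrix.trace]
  refine Finset.sum_congr rfl fun i _ => ?_
  rw [Matrix.diag_apply, LinearMap.toMatrix_apply, h, b.repr_sum_self (fun l => A l i)]

/-- If φ ∘ w = φ, then p and w(p) lie in one batch and share a block, so they coincide. -/
theorem fixedPointFree_of_mem_parabolic (α : Fin r → ℕ) (w : parabolic α) (hw : w ≠ 1)
    (φ : BlockMap α k) : φ.1 ∘ w.1 ≠ φ.1 := by
  intro h
  apply hw
  ext p : 2
  obtain ⟨j, hj⟩ := exists_batchIndex α _ p rfl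
  obtain ⟨l, hl⟩ := exists_batchIndex α _ (w.1 p) (w.2 p)
  have h1 : φ.1 (w.1 p) = φ.1 p := congrFun h p
  rw [← hl] at h1
  nth_rw 2 [← hj] at h1
  have h2 := φ.2.2 _ h1
  rw [← hl, h2, hj]
  rfl

theorem comp_injective_batch (α : Fin r → ℕ) (w : parabolic α) (φ : BlockMap α k) (i : Fin r) :
    Function.Injective fun j => (φ.1 ∘ w.1) (batchIndex α i j) := by
  intro j l h
  obtain ⟨j', hj⟩ := exists_batchIndex α i (w.1 (batchIndex α i j))
    ((w.2 _).trans (batchOf_batchIndex α i j))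
  obtain ⟨l', hl⟩ := exists_batchIndex α i (w.1 (batchIndex α i l))
    ((w.2 _).trans (batchOf_batchIndex α i l))
  simp only [Function.comp_apply, ← hj, ← hl] at h
  have h1 := φ.2.2 i h
  rw [h1, hl] at hj
  exact batchIndex_injective α i (w.1.injective hj).symm

/-- The right action of the parabolic subgroup on block maps. -/
def blockMapComp (α : Fin r → ℕ) (w : parabolic α) (φ : BlockMap α k) : BlockMap α k :=
  ⟨φ.1 ∘ w.1, φ.2.1.comp w.1.surjective, comp_injective_batch α w φ⟩

/-- In the basis of standard monomials, A is the matrix of composition with w on functions on the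
points. In the basis of indicator functions the same map is a permutation matrix without fixed
points, so the trace is zero. -/
theorem sum_diag_eq_zero [Nontrivial S] [FaithfulSMul S K] (α : Fin r → ℕ) (hα : ∀ i, α i ≤ k)
    (z : Fin k → S) (hz : Function.Injective fun b => algebraMap S K (z b))
    [Fintype (standardExps α k)] (w : parabolic α) (hw : w ≠ 1)
    (A : standardExps α k → standardExps α k → S)
    (hA : ∀ m, rename w.1 (monomial m.1 (1 : S)) - ∑ m', A m' m • monomial m'.1 (1 : S) ∈
      deformedIdeal α z) : ∑ m, A m m = 0 := by
  classical
  let L : (BlockMap α k → K) →ₗ[K] (BlockMap α k → K) := LinearMap.funLeft K K (blockMapComp α w)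
  have h1 := trace_eq_sum_of_basis (pointBasis α hα z hz) L (fun i j => algebraMap S K (A i j)) (by
    intro m
    have h := pointValues_eq_zero (K := K) α z _ (hA m)
    rw [map_sub, sub_eq_zero, map_sum] at h
    have h2 : L (pointBasis α hα z hz m) =
        pointValues K α z (rename w.1 (monomial m.1 (1 : S))) := by
      funext φ
      rw [pointBasis_apply, pointValues_apply, eval_rename, LinearMap.funLeft_apply,
        pointValues_apply]
      rfl
    rw [h2, h]
    refine Finset.sum_congr rfl fun m' _ => ?_
    rw [map_smul, pointBasis_apply, algebraMap_smul])
  have h2 := trace_eq_sum_of_basis (Pi.basisFun K (BlockMap α k)) L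
    (fun i j => L (Pi.single j 1) i) (by
      intro j
      rw [Pi.basisFun_apply]
      funext φ
      simp [Finset.sum_apply, Pi.single_apply])
  rw [h2, ← map_sum, Finset.sum_eq_zero] at h1
  · exact (map_eq_zero_iff _ (FaithfulSMul.algebraMap_injective S K)).1 h1.symm
  · intro φ _
    rw [LinearMap.funLeft_apply, Pi.single_eq_of_ne]
    exact fun h => fixedPointFree_of_mem_parabolic α w hw φ (congrArg Subtype.val h)

end Points

/-! ### Specialization at t = 0 -/

section Specialization

variable {r k : ℕ}

/-- The parameters `0, t, 2 t, …` in `ℤ[t]`. -/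
noncomputable def lineParams (k : ℕ) (b : Fin k) : Polynomial ℤ :=
  Polynomial.C (b : ℤ) * Polynomial.X

theorem lineParams_injective (k : ℕ) : Function.Injective fun b : Fin k =>
    algebraMap (Polynomial ℤ) (FractionRing (Polynomial ℤ)) (lineParams k b) := by
  intro a b h
  have h1 := FaithfulSMul.algebraMap_injective (Polynomial ℤ) (FractionRing (Polynomial ℤ)) h
  have h2 := congrArg (fun p => Polynomial.coeff p 1) h1
  simp only [lineParams, Polynomial.coeff_C_mul, Polynomial.coeff_X_one, mul_one] at h2
  exact Fin.ext (by exact_mod_cast h2)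

theorem map_deformedIdeal_lineParams (α : Fin r → ℕ) (k : ℕ) :
    (deformedIdeal α (lineParams k)).map (MvPolynomial.map Polynomial.constantCoeff) =
      idealI α k := by
  rw [map_deformedIdeal, ← deformedIdeal_zero]
  congr 1
  funext b
  simp [lineParams]

theorem map_mem_idealI (α : Fin r → ℕ) (f : MvPolynomial (Fin (compSize α)) (Polynomial ℤ))
    (hf : f ∈ deformedIdeal α (lineParams k)) :
    MvPolynomial.map Polynomial.constantCoeff f ∈ idealI α k := by
  rw [← map_deformedIdeal_lineParams]
  exact Ideal.mem_map_of_mem _ hf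

/-- A relation at t = 0 lifts to F in the deformed ideal, differing from ∑ c_m x^m by some tG.
Reducing G to standard monomials gives a relation over ℤ[t] with coefficients c_m - t s_m. These
vanish, and t = 0 gives c_m = 0. -/
theorem eq_zero_of_sum_mem_idealI (α : Fin r → ℕ) (hα : ∀ i, α i ≤ k)
    [Fintype (standardExps α k)] (c : standardExps α k → ℤ)
    (hc : ∑ m, c m • monomial m.1 (1 : ℤ) ∈ idealI α k) (m : standardExps α k) : c m = 0 := by
  rw [← map_deformedIdeal_lineParams, Ideal.mem_map_iff_of_surjective _
    (MvPolynomial.map_surjective _ fun a => ⟨Polynomial.C a, by simp⟩)] at hc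
  obtain ⟨F, hF, h1⟩ := hc
  have h2 : C (Polynomial.X : Polynomial ℤ) ∣
      ∑ m, Polynomial.C (c m) • monomial m.1 (1 : Polynomial ℤ) - F := by
    rw [C_dvd_iff_map_hom_eq_zero Polynomial.constantCoeff Polynomial.X fun p => by
      rw [Polynomial.X_dvd_iff, Polynomial.constantCoeff_apply], map_sub, h1, map_sum, sub_eq_zero]
    refine Finset.sum_congr rfl fun m _ => ?_
    rw [smul_monomial, smul_monomial, map_monomial]
    simp
  obtain ⟨G, hG⟩ := h2
  obtain ⟨s, hs⟩ := exists_sub_sum_mem_deformedIdeal α (lineParams k) G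
  have h3 : ∑ m, (Polynomial.C (c m) - Polynomial.X * s m) • monomial m.1 (1 : Polynomial ℤ) ∈
      deformedIdeal α (lineParams k) := by
    have h4 : ∑ m, (Polynomial.C (c m) - Polynomial.X * s m) • monomial m.1 (1 : Polynomial ℤ) =
        F + C (Polynomial.X : Polynomial ℤ) *
          (G - ∑ m, s m • monomial m.1 (1 : Polynomial ℤ)) := by
      rw [mul_sub, ← hG, Finset.mul_sum]
      simp only [sub_smul, Finset.sum_sub_distrib, mul_smul, ← C_mul']
      ring
    rw [h4]
    exact add_mem hF (Ideal.mul_mem_left _ _ hs)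
  have h5 := eq_zero_of_sum_mem_deformedIdeal (K := FractionRing (Polynomial ℤ)) α hα _
    (lineParams_injective k) _ h3 m
  simpa using congrArg Polynomial.constantCoeff h5

theorem sum_smul_mk (α : Fin r → ℕ) [Fintype (standardExps α k)] (c : standardExps α k → ℤ) :
    Ideal.Quotient.mk (idealI α k) (∑ m, c m • monomial m.1 (1 : ℤ)) =
      ∑ m, c m • Ideal.Quotient.mk (idealI α k) (monomial m.1 (1 : ℤ)) := by
  rw [map_sum]
  exact Finset.sum_congr rfl fun m _ => map_zsmul _ _ _

theorem linearIndependent_standard (α : Fin r → ℕ) (hα : ∀ i, α i ≤ k) :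
    LinearIndependent ℤ fun m : standardExps α k =>
      Ideal.Quotient.mk (idealI α k) (monomial m.1 (1 : ℤ)) := by
  have := Fintype.ofFinite (standardExps α k)
  rw [Fintype.linearIndependent_iff]
  intro c hc
  rw [← sum_smul_mk, Ideal.Quotient.eq_zero_iff_mem] at hc
  exact eq_zero_of_sum_mem_idealI α hα c hc

theorem span_standard (α : Fin r → ℕ) (k : ℕ) :
    ⊤ ≤ Submodule.span ℤ (Set.range fun m : standardExps α k =>
      Ideal.Quotient.mk (idealI α k) (monomial m.1 (1 : ℤ))) := by
  have := Fintype.ofFinite (standardExps α k)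
  intro x _
  obtain ⟨f, rfl⟩ := Ideal.Quotient.mk_surjective x
  obtain ⟨c, hc⟩ := exists_sub_sum_mem_deformedIdeal α (0 : Fin k → ℤ) f
  rw [deformedIdeal_zero, ← Ideal.Quotient.mk_eq_mk_iff_sub_mem, sum_smul_mk] at hc
  rw [hc]
  exact Submodule.sum_mem _ fun m _ => Submodule.smul_mem _ _ (Submodule.subset_span ⟨m, rfl⟩)

/-- The basis of standard monomials of `R_{α,k}`. -/
noncomputable def standardBasis (α : Fin r → ℕ) (hα : ∀ i, α i ≤ k) :
    Module.Basis (standardExps α k) ℤ (ringR α k) :=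
  Module.Basis.mk (linearIndependent_standard α hα) (span_standard α k)

theorem standardBasis_apply (α : Fin r → ℕ) (hα : ∀ i, α i ≤ k) (m : standardExps α k) :
    standardBasis α hα m = Ideal.Quotient.mk (idealI α k) (monomial m.1 1) := by
  simp [standardBasis]

theorem finrank_ringR (α : Fin r → ℕ) (hα : ∀ i, α i ≤ k) :
    Module.finrank ℤ (ringR α k) = (orderedPartitions α k).ncard := by
  rw [Module.finrank_eq_nat_card_basis (standardBasis α hα),
    card_standardExps_eq_card_blockMap α k hα, ncard_orderedPartitions]

end Specialization

/-! ### Traces and the rank of the invariants -/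

section Invariants

variable {r k : ℕ}

theorem permAct_mk (α : Fin r → ℕ) (k : ℕ) (w : parabolic α)
    (f : MvPolynomial (Fin (compSize α)) ℤ) :
    permAct α k w (Ideal.Quotient.mk _ f) = Ideal.Quotient.mk _ (rename w.1 f) := rfl

theorem permAct_permAct (α : Fin r → ℕ) (k : ℕ) (v w : parabolic α) (x : ringR α k) :
    permAct α k v (permAct α k w x) = permAct α k (v * w) x := by
  obtain ⟨f, rfl⟩ := Ideal.Quotient.mk_surjective x
  rw [permAct_mk, permAct_mk, permAct_mk, rename_rename]
  rfl

theorem permAct_one (α : Fin r → ℕ) (k : ℕ) (x : ringR α k) : permAct α k 1 x = x := by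
  obtain ⟨f, rfl⟩ := Ideal.Quotient.mk_surjective x
  rw [permAct_mk]
  exact congrArg _ (rename_id_apply f)

/-- Reduction to standard monomials already works over ℤ[t], so the matrix of w has entries there;
its trace is zero over ℤ[t] and remains so at t = 0. -/
theorem trace_permAct_eq_zero (α : Fin r → ℕ) (hα : ∀ i, α i ≤ k) (w : parabolic α) (hw : w ≠ 1) :
    LinearMap.trace ℤ (ringR α k) (permAct α k w).toLinearMap = 0 := by
  have := Fintype.ofFinite (standardExps α k)
  choose A hA using fun m : standardExps α k => exists_sub_sum_mem_deformedIdeal α (lineParams k)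
    (rename w.1 (monomial m.1 (1 : Polynomial ℤ)))
  have h1 := sum_diag_eq_zero (K := FractionRing (Polynomial ℤ)) α hα _ (lineParams_injective k) w
    hw (fun m' m => A m m') hA
  rw [trace_eq_sum_of_basis (standardBasis α hα) _
    (fun m' m => Polynomial.constantCoeff (A m m')), ← map_sum, h1, map_zero]
  intro m
  have h2 := map_mem_idealI α _ (hA m)
  have h3 : MvPolynomial.map Polynomial.constantCoeff
      (rename w.1 (monomial m.1 (1 : Polynomial ℤ)) -
        ∑ m', A m m' • monomial m'.1 (1 : Polynomial ℤ)) =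
      rename w.1 (monomial m.1 (1 : ℤ)) -
        ∑ m', Polynomial.constantCoeff (A m m') • monomial m'.1 (1 : ℤ) := by
    rw [map_sub, map_rename, map_monomial, map_one, map_sum]
    congr 1
    refine Finset.sum_congr rfl fun m' _ => ?_
    rw [smul_monomial, smul_monomial, map_monomial]
    simp
  rw [h3, ← Ideal.Quotient.mk_eq_mk_iff_sub_mem, sum_smul_mk] at h2
  simp only [standardBasis_apply]
  exact h2

theorem card_parabolic (α : Fin r → ℕ) : Nat.card (parabolic α) = ∏ i, (α i).factorial := by
  classical
  have e : parabolic α ≃ {g : Equiv.Perm (Fin (compSize α)) // batchOf α ∘ g = batchOf α} :=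
    Equiv.subtypeEquivRight fun g => by
      rw [funext_iff]
      rfl
  rw [Nat.card_congr e, Nat.card_eq_fintype_card, DomMulAct.stabilizer_card]
  refine Finset.prod_congr rfl fun i _ => ?_
  congr 1
  rw [← Fintype.card_fin (α i)]
  refine (Fintype.card_congr (Equiv.ofBijective
    (fun j : Fin (α i) => (⟨batchIndex α i j, batchOf_batchIndex α i j⟩ :
      {p // batchOf α p = i})) ⟨fun a b h => ?_, fun p => ?_⟩)).symm
  · exact batchIndex_injective α i (congrArg Subtype.val h)
  · obtain ⟨j, hj⟩ := exists_batchIndex α i p.1 p.2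
    exact ⟨j, Subtype.ext hj⟩

/-- Let e be the sum of all group elements, regarded as a map p onto its values in the invariants
followed by the inclusion i. Then tr(i ∘ p) = tr(e) is the rank of R_{α,k}, as only the identity
contributes, while p ∘ i is multiplication by the group order. No division is needed, so the
argument runs over ℤ. -/
theorem card_mul_finrank_invariantSubring (α : Fin r → ℕ) (hα : ∀ i, α i ≤ k)
    [Module.Free ℤ (ringR α k)] [Module.Finite ℤ (ringR α k)]
    [Module.Free ℤ (invariantSubring α k)] [Module.Finite ℤ (invariantSubring α k)] :
    Nat.card (parabolic α) * Module.finrank ℤ (invariantSubring α k) =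
      Module.finrank ℤ (ringR α k) := by
  have := Fintype.ofFinite (parabolic α)
  let e : ringR α k →ₗ[ℤ] ringR α k := ∑ w : parabolic α, (permAct α k w).toLinearMap
  have he : ∀ x, e x = ∑ w : parabolic α, permAct α k w x := by
    intro x
    simp [e]
  have hmem : ∀ x, e x ∈ Subalgebra.toSubmodule (invariantSubring α k) := by
    intro x
    rw [Subalgebra.mem_toSubmodule, mem_invariantSubring]
    intro v
    rw [he, map_sum]
    simp only [permAct_permAct]
    exact Equiv.sum_comp (Equiv.mulLeft v) fun w => permAct α k w x
  let p : ringR α k →ₗ[ℤ] invariantSubring α k :=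
    e.codRestrict (Subalgebra.toSubmodule (invariantSubring α k)) hmem
  let i : invariantSubring α k →ₗ[ℤ] ringR α k := (invariantSubring α k).val.toLinearMap
  have h1 : i.comp p = e := rfl
  have h2 : p.comp i = (Nat.card (parabolic α) : ℤ) • LinearMap.id := by
    ext x
    have h3 : ∀ w : parabolic α, permAct α k w x.1 = x.1 := (mem_invariantSubring α k x.1).1 x.2
    change e x.1 = ((Nat.card (parabolic α) : ℤ) • x : invariantSubring α k).1
    rw [he, Finset.sum_congr rfl fun w _ => h3 w]
    simp
  have h4 := LinearMap.trace_comp_comm' p i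
  rw [h1, h2, map_smul, LinearMap.trace_id, map_sum, Finset.sum_eq_single 1] at h4
  · have h5 : (permAct α k 1).toLinearMap = LinearMap.id :=
      LinearMap.ext fun x => permAct_one α k x
    rw [h5, LinearMap.trace_id, smul_eq_mul] at h4
    exact_mod_cast h4.symm
  · intro w _ hw
    exact trace_permAct_eq_zero α hα w hw
  · exact fun h => absurd (Finset.mem_univ _) h

end Invariants

theorem mainTheorem5 (r k : ℕ) (hk : 0 < k) (α : Fin r → ℕ)
    (hα : ∀ i, 1 ≤ α i ∧ α i ≤ k) :
    (Module.Free ℤ (ringR α k) ∧ Module.Finite ℤ (ringR α k) ∧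
      Module.finrank ℤ (ringR α k) = (orderedPartitions α k).ncard ∧
      ∃ b : Module.Basis (nonskip α k) ℤ (ringR α k),
        ∀ m : nonskip α k,
          b m = Ideal.Quotient.mk (idealI α k) (MvPolynomial.monomial m.1 1)) ∧
    (Module.Free ℤ (invariantSubring α k) ∧ Module.Finite ℤ (invariantSubring α k) ∧
      (Module.finrank ℤ (invariantSubring α k) : ℚ) =
        ((orderedPartitions α k).ncard : ℚ) / ∏ i, ((α i).factorial : ℚ)) := by
  have hα' : ∀ i, α i ≤ k := fun i => (hα i).2
  have hfree : Module.Free ℤ (ringR α k) := Module.Free.of_basis (standardBasis α hα')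
  have hfin : Module.Finite ℤ (ringR α k) := Module.Finite.of_basis (standardBasis α hα')
  -- The invariants form a submodule of a finite free module over the principal ideal domain ℤ.
  have hfree' : Module.Free ℤ (invariantSubring α k) :=
    inferInstanceAs (Module.Free ℤ (Subalgebra.toSubmodule (invariantSubring α k)))
  have hfin' : Module.Finite ℤ (invariantSubring α k) :=
    inferInstanceAs (Module.Finite ℤ (Subalgebra.toSubmodule (invariantSubring α k)))
  refine ⟨⟨hfree, hfin, finrank_ringR α hα', ?_⟩, hfree', hfin', ?_⟩
  · rw [nonskip_eq_standardExps α hk]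
    exact ⟨standardBasis α hα', standardBasis_apply α hα'⟩
  · have h := card_mul_finrank_invariantSubring α hα'
    rw [card_parabolic, finrank_ringR α hα'] at h
    rw [eq_div_iff (Finset.prod_ne_zero_iff.2 fun i _ => by
      exact_mod_cast (α i).factorial_ne_zero), ← h]
    push_cast
    ring
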